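/- **Theorem (Capacity region of a quantum switch).** A quantum switch serves $K$ end nodes $\mathcal K=\{1,\dots,K\}$ in slotted time $t=0,1,2,\dots$. Let $p_k\in[0,1]$ $(k\in\mathcal K)$, $q\in[0,1]$ and $W\in\{0,1,2,\dots\}\cup\{\infty\}$. All quantities indexed by $ij$ belong to unordered pairs of distinct end nodes. Thus they are symmetric in $i,j$, vanish for $i=j$, and $\sum_{i<j}$ counts every pair once. *Model.* In slot $t$: $C_{0j}(t)\in\{0,1\}$ EPR pairs are generated between the switch and node $j$, where the $C_{0j}(t)$ are independent Bernoulli variables with parameter $p_j$; $A_{ij}(t)\in\mathbb N$ requests arrive for the pair $ij$, where for each $ij$ the process $(A_{ij}(t))_{t\ge0}$ is stationary and ergodic with mean $\lambda_{ij}$ and its second moment conditional on the past is bounded, uniformly in the slot and the past, and the processes of different pairs are independent; and the switch attempts $F_{ij}(t)\in\mathbb N$ entanglement swaps for each pair $ij$. Each attempt consumes one stored EPR pair of the switch with $i$ and one with $j$, and succeeds independently with probability $q$. Let $R_{ij}(t)$ be the number of successes. Requests, pair generation and swap outcomes are independent of each other. A swapping protocol chooses $F(t)$ as a function of the history before slot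 $t$ and of independent private randomness, subject to $\sum_{i}F_{ij}(t)\le E_{0j}(t)$ for all $j$ and $\sum_{i<j}F_{ij}(t)\le W$. The numbers $U_{ij}$ of pending requests, $E_{ij}$ of stored EPR pairs between $i$ and $j$, and $E_{0j}$ of stored EPR pairs between the switch and $j$ start at $0$ and evolve by $$U_{ij}(t+1)=[U_{ij}(t)-E_{ij}(t)-R_{ij}(t)]^++A_{ij}(t),\qquad E_{ij}(t+1)=[E_{ij}(t)+R_{ij}(t)-U_{ij}(t)]^+,$$ $$E_{0j}(t+1)=E_{0j}(t)-\sum_i F_{ij}(t)+C_{0j}(t).$$ The switch is *stable* if for every pair $ij$ $$\lim_{V\to\infty}\ \limsup_{t\to\infty}\frac1t\sum_{\tau=0}^{t-1}\mathbb P[U_{ij}(\tau)>V]=0 .$$ A *rate matrix* is a symmetric matrix with nonnegative entries and zero diagonal. The *capacity region* is the closure of the set of rate matrices $(\lambda_{ij})$ for which some swapping protocol stabilizes the switch for all request processes as above with rates $\lambda_{ij}$. *Claim.* Let $\Lambda$ be the set of rate matrices $(\lambda_{ij})$ for which there is a symmetric nonnegative matrix $(f_{ij})$ with zero diagonal such that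 $$\sum_{i}f_{ij}\le p_j\ \ (j\in\mathcal K),\qquad \sum_{i<j}f_{ij}\le W,\qquad \lambda_{ij}\le q\,f_{ij}\ \ (i,j\in\mathcal K).$$ 1. The capacity region is equal to $\Lambda$. 2. If $(\lambda_{ij})$ is a rate matrix and some swapping protocol stabilizes the switch for some request processes as above with rates $\lambda_{ij}$, then $(\lambda_{ij})\in\Lambda$. 3. If $(\lambda_{ij})$ is a rate matrix and, for some $\varepsilon>0$, the matrix with off-diagonal entries $\lambda_{ij}+\varepsilon$ and zero diagonal is in $\Lambda$, then there is a swapping protocol that stabilizes the switch for all request processes as above with rates $\lambda_{ij}$. -/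

import Mathlib

open MeasureTheory ProbabilityTheory Filter Topology
open scoped ENNReal

/-- Unordered pairs of distinct end nodes. -/
abbrev UserPair (K : ℕ) : Type := {e : Sym2 (Fin K) // ¬ e.IsDiag}

/-- The pair formed by two distinct end nodes `i` and `j`. -/
def userPair {K : ℕ} (i j : Fin K) (hij : i ≠ j) : UserPair K :=
  ⟨s(i, j), fun h => hij (Sym2.mk_isDiag_iff.mp h)⟩

/-- What happens in one time slot: the numbers `A e` of requests that arrive, `C j` of EPR pairs
generated between the switch and node `j`, `F e` of swaps that are attempted, and `R e` of swaps
that succeed. -/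
structure SlotRecord (K : ℕ) where
  A : UserPair K → ℕ
  C : Fin K → ℕ
  F : UserPair K → ℕ
  R : UserPair K → ℕ

/-- The records of all past slots, the most recent one first. -/
abbrev History (K : ℕ) : Type := List (SlotRecord K)

/-- State of the switch at the beginning of a slot: pending requests `U e`, stored EPR pairs `E e`
between end nodes, and stored EPR pairs `E₀ j` between the switch and node `j`. -/
structure SwitchState (K : ℕ) where
  U : UserPair K → ℕ
  E : UserPair K → ℕ
  E₀ : Fin K → ℕ

/-- Evolution of the state over one slot. The truncated subtraction of `ℕ` is `[x]⁺`; in the last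
line no truncation occurs under a protocol, which never uses more pairs than are stored. -/
def SwitchState.next {K : ℕ} (x : SwitchState K) (r : SlotRecord K) : SwitchState K where
  U e := (x.U e - (x.E e + r.R e)) + r.A e
  E e := (x.E e + r.R e) - x.U e
  E₀ j := (x.E₀ j - ∑ e : UserPair K with j ∈ e.1, r.F e) + r.C j

/-- The state reached after a history; the switch starts empty. -/
def History.state {K : ℕ} : History K → SwitchState K
  | [] => ⟨fun _ => 0, fun _ => 0, fun _ => 0⟩
  | r :: h => (History.state h).next r

/-- An entanglement swapping protocol for a switch that can perform at most `W` swaps per slot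
(`W = ⊤`: no limit): in each slot it chooses the numbers of swaps to attempt, from the past and
from private randomness (the seed), subject to the EPR pairs that are available. -/
structure Protocol (K : ℕ) (W : ℕ∞) where
  Seed : Type
  [mSeed : MeasurableSpace Seed]
  seedLaw : ProbabilityMeasure Seed
  attempts : History K → Seed → UserPair K → ℕ
  measurable_attempts : ∀ h, Measurable (attempts h)
  attempts_le_stored : ∀ h s (j : Fin K),
    ∑ e : UserPair K with j ∈ e.1, attempts h s e ≤ (History.state h).E₀ j
  attempts_le_limit : ∀ h s, ((∑ e : UserPair K, attempts h s e : ℕ) : ℕ∞) ≤ W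

attribute [instance] Protocol.mSeed

/-- Outcomes of all the randomness: the requests that arrive for a pair in a slot; the EPR pairs
(0 or 1) generated with a node in a slot; the success (1) or failure (0) of the `n`-th swap that is
attempted for a pair in a slot; and the seed. -/
abbrev Sample (K : ℕ) (S : Type) : Type :=
  (UserPair K → ℕ → ℕ) × (Fin K × ℕ → ℕ) × (UserPair K × ℕ × ℕ → ℕ) × S

section Dynamics

variable {K : ℕ} {W : ℕ∞}

/-- The history of the slots `0, …, t - 1` when protocol `π` is run. -/
def runHistory (π : Protocol K W) (ω : Sample K π.Seed) : ℕ → History K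
  | 0 => []
  | t + 1 =>
    { A := fun e => ω.1 e t
      C := fun j => ω.2.1 (j, t)
      F := π.attempts (runHistory π ω t) ω.2.2.2
      R := fun e => ∑ n ∈ Finset.range (π.attempts (runHistory π ω t) ω.2.2.2 e),
        ω.2.2.1 (e, t, n) } :: runHistory π ω t

/-- The number of pending requests for the pair `e` at time `t`. -/
def pendingRequests (π : Protocol K W) (e : UserPair K) (t : ℕ) (ω : Sample K π.Seed) : ℕ :=
  (History.state (runHistory π ω t)).U e

/-- The joint law: request processes of different pairs, generation of EPR pairs (Bernoulli with
parameter `p j`), swap outcomes (Bernoulli with parameter `q`) and the seed are all independent. -/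
noncomputable def switchLaw (p : Fin K → unitInterval) (q : unitInterval) (π : Protocol K W)
    (α : UserPair K → ProbabilityMeasure (ℕ → ℕ)) : Measure (Sample K π.Seed) :=
  (Measure.pi fun e => (α e : Measure (ℕ → ℕ))).prod
    ((Measure.infinitePi fun x : Fin K × ℕ => bernoulliMeasure (1 : ℕ) 0 (p x.1)).prod
      ((Measure.infinitePi fun _ : UserPair K × ℕ × ℕ => bernoulliMeasure (1 : ℕ) 0 q).prod
        (π.seedLaw : Measure π.Seed)))

/-- The long-run fraction of time for which more than `V` requests for `e` are pending. -/
noncomputable def overflow (p : Fin K → unitInterval) (q : unitInterval) (π : Protocol K W)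
    (α : UserPair K → ProbabilityMeasure (ℕ → ℕ)) (e : UserPair K) (V : ℝ) : ℝ :=
  limsup (fun t : ℕ => (1 / (t : ℝ)) * ∑ τ ∈ Finset.range t,
    (switchLaw p q π α).real {ω | V < (pendingRequests π e τ ω : ℝ)}) atTop

/-- Stability of the switch. -/
def SwitchStable (p : Fin K → unitInterval) (q : unitInterval) (π : Protocol K W)
    (α : UserPair K → ProbabilityMeasure (ℕ → ℕ)) : Prop :=
  ∀ e : UserPair K, Tendsto (fun V : ℝ => overflow p q π α e V) atTop (𝓝 0)

end Dynamics

/-- `α` is the law of a stationary ergodic request process of rate `r` whose second moment, in every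
slot and conditionally on the past, is bounded. Since the request processes of the other pairs, the
generation of EPR pairs, the swap outcomes and the seed are independent of this process, bounding
the conditional second moment given its own past is the same as bounding it given the whole history
of the switch, under any protocol. -/
structure IsRequestLaw (α : ProbabilityMeasure (ℕ → ℕ)) (r : ℝ) : Prop where
  ergodic : Ergodic (fun (a : ℕ → ℕ) (t : ℕ) => a (t + 1)) (α : Measure (ℕ → ℕ))
  integrable : Integrable (fun a : ℕ → ℕ => (a 0 : ℝ)) (α : Measure (ℕ → ℕ))
  rate : ∫ a, (a 0 : ℝ) ∂(α : Measure (ℕ → ℕ)) = r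
  second_moment : ∃ Amax : ℝ, ∀ (t : ℕ) (h : ℕ → ℕ),
    ∫⁻ a in {a : ℕ → ℕ | ∀ τ < t, a τ = h τ}, (a t : ℝ≥0∞) ^ 2 ∂(α : Measure (ℕ → ℕ))
      ≤ ENNReal.ofReal (Amax ^ 2) * (α : Measure (ℕ → ℕ)) {a : ℕ → ℕ | ∀ τ < t, a τ = h τ}

/-- The requests for nodes `i ≠ j` arrive at rate `lam i j`. -/
def HasRates {K : ℕ} (α : UserPair K → ProbabilityMeasure (ℕ → ℕ))
    (lam : Matrix (Fin K) (Fin K) ℝ) : Prop :=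
  ∀ (i j : Fin K) (hij : i ≠ j), IsRequestLaw (α (userPair i j hij)) (lam i j)

/-- Nonnegative numbers attached to the unordered pairs of distinct nodes, written as a symmetric
matrix with zero diagonal. -/
structure IsRateMatrix {K : ℕ} (lam : Matrix (Fin K) (Fin K) ℝ) : Prop where
  symm : ∀ i j, lam i j = lam j i
  diag : ∀ i, lam i i = 0
  nonneg : ∀ i j, 0 ≤ lam i j

/-- The capacity region: the closure of the set of rate matrices for which some protocol stabilizes
the switch, whatever the request processes with these rates are. -/
def capacityRegion {K : ℕ} (p : Fin K → unitInterval) (q : unitInterval) (W : ℕ∞) :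
    Set (Matrix (Fin K) (Fin K) ℝ) :=
  closure {lam | IsRateMatrix lam ∧
    ∃ π : Protocol K W, ∀ α, HasRates α lam → SwitchStable p q π α}

/-- The explicit region. The second sum runs over unordered pairs: every swap counts once. -/
def flowRegion {K : ℕ} (p : Fin K → unitInterval) (q : unitInterval) (W : ℕ∞) :
    Set (Matrix (Fin K) (Fin K) ℝ) :=
  {lam | IsRateMatrix lam ∧ ∃ f : Matrix (Fin K) (Fin K) ℝ, IsRateMatrix f ∧
    (∀ j, ∑ i, f i j ≤ (p j : ℝ)) ∧
    ENNReal.ofReal (∑ i, ∑ j with i < j, f i j) ≤ (W : ℝ≥0∞) ∧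
    ∀ i j, lam i j ≤ (q : ℝ) * f i j}

/-!
The number of pending requests for a pair, minus the number of EPR pairs stored for it, is always
the number of arrived requests minus the number of successful swaps. Both directions rest on this
balance.

*Necessity.* A stable switch has, at arbitrarily late times `t`, short queues with high
probability (`SwitchStable.exists_time`). At such a time almost all requests have been served by
successful swaps; the requests that arrive on the exceptional event are few, because second
moments are bounded (`rate_mul_le`). Since the swaps of a slot are decided before their outcomes
are drawn, the mean number of successes is `q` times the mean number of attempts
(`lintegral_successesAt`). The mean numbers of attempts per slot obey the constraints of a flow
(`isFlow_meanAttempts`), and flows form a compact set, so a limit of them serves the rates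
(`SwitchStable.mem_flowRegion`). The same compactness shows that the flow region is closed. Every
rate is the rate of some request process, for instance an independent, identically distributed one
(`exists_isRequestLaw`), which gives one inclusion for the capacity region.

*Sufficiency.* EPR pairs between end nodes are never lost. Hence as soon as the successful swaps
outnumber the requests, at most the requests of the last slot are pending
(`pendingRequests_succ_le`), and weak laws of large numbers for requests and for swaps suffice. A
flow that serves the rates with room to spare is scaled down slightly and turned into a
deterministic schedule, which serves at most one pair per slot, always with the same number of
swaps (the limit, if there is one), and serves the pairs with prescribed frequencies
(`exists_seq_tendsto_frequency`). The scheduled attempts use EPR pairs at each relevant node at a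
smaller rate than they are generated, so that the fraction of scheduled slots with a shortage
tends to zero. Requests obey a weak law by the mean ergodic theorem
(`Ergodic.tendsto_measureReal_lt_sum`), the Bernoulli variables by Chebyshev's inequality. This is
`switchStable_scheduledProtocol`. Pairs without requests need no service, so the argument applies
to `(1 - δ) lam` for every `lam` in the flow region, even if some nodes generate no EPR pairs;
this gives the other inclusion for the capacity region.
-/

/-! ### Ergodic processes -/

/-- The shift is ergodic for independent, identically distributed sequences: a shift-invariant
event belongs to the tail σ-algebra, so Kolmogorov's 0-1 law applies. -/
lemma ergodic_shift_infinitePi {X : Type*} [MeasurableSpace X] (μ : Measure X)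
    [IsProbabilityMeasure μ] :
    Ergodic (fun (a : ℕ → X) (t : ℕ) => a (t + 1)) (Measure.infinitePi fun _ : ℕ => μ) where
  measurable := by fun_prop
  map_eq := Measure.map_infinitePi_infinitePi_of_inj (P := fun _ : ℕ => μ)
    (f := fun t : ℕ => t + 1) (add_left_injective 1)
  aeconst_set s hs hinv := by
    have hiter : ∀ n : ℕ, {a : ℕ → X | (fun k => a (k + n)) ∈ s} = s := by
      intro n
      induction n with
      | zero => rfl
      | succ n ih =>
        nth_rewrite 2 [← ih]
        ext a
        have h := Set.ext_iff.1 hinv (fun k => a (k + n))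
        simp only [Set.mem_preimage] at h
        rw [Set.mem_ofPred_eq, Set.mem_ofPred_eq, ← h]
        simp only [add_comm, add_left_comm]
    have hind : iIndep (fun n : ℕ => MeasurableSpace.comap (fun a : ℕ → X => a n) inferInstance)
        (Measure.infinitePi fun _ : ℕ => μ) :=
      iIndepFun_infinitePi (P := fun _ : ℕ => μ) (X := fun _ x => x) (fun _ => measurable_id)
    have htail : MeasurableSet[limsup (fun n : ℕ =>
        MeasurableSpace.comap (fun a : ℕ → X => a n) inferInstance) atTop] s := by
      rw [limsup_eq_iInf_iSup_of_nat, MeasurableSpace.measurableSet_iInf]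
      intro n
      rw [← hiter n]
      refine @measurable_pi_iff (ℕ → X) ℕ (fun _ => X)
        (⨆ i, ⨆ (_ : i ≥ n), MeasurableSpace.comap (fun a : ℕ → X => a i) inferInstance) _
        (fun a k => a (k + n)) |>.2 (fun k => ?_) hs
      refine Measurable.mono (comap_measurable fun a : ℕ → X => a (k + n)) ?_ le_rfl
      exact le_iSup₂_of_le (f := fun (i : ℕ) (_ : i ≥ n) =>
        MeasurableSpace.comap (fun a : ℕ → X => a i) inferInstance) (k + n) (by omega) le_rfl
    have h01 := measure_zero_or_one_of_measurableSet_limsup_atTop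
      (fun n => (measurable_pi_apply n).comap_le) hind htail
    rw [Filter.eventuallyConst_set']
    rcases h01 with h | h
    · exact Or.inl (ae_eq_empty.2 h)
    · exact Or.inr (eventuallyEq_univ.2 ((mem_ae_iff_prob_eq_one hs).2 h))

/-- Weak law of large numbers for square integrable observables of an ergodic map, a consequence
of von Neumann's mean ergodic theorem. -/
lemma Ergodic.tendsto_measureReal_lt_sum {Ω : Type*} [MeasurableSpace Ω] {μ : Measure Ω}
    [IsProbabilityMeasure μ] {T : Ω → Ω} (hT : Ergodic T μ) {f : Ω → ℝ} (hf : MemLp f 2 μ)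
    {r : ℝ} (hr : ∫ x, f x ∂μ < r) :
    Tendsto (fun n : ℕ => μ.real {x | r * n < ∑ i ∈ Finset.range n, f (T^[i] x)}) atTop (𝓝 0) := by
  set m := ∫ x, f x ∂μ with hm
  have hmp := hT.toMeasurePreserving
  have hg : MemLp (fun x => f x - m) 2 μ := hf.sub (memLp_const m)
  set φ : Lp ℝ 2 μ := hg.toLp _ with hφ
  let U : Lp ℝ 2 μ →L[ℝ] Lp ℝ 2 μ :=
    (Lp.compMeasurePreservingₗᵢ ℝ T hmp).toContinuousLinearMap
  have hU : ∀ ψ : Lp ℝ 2 μ, U ψ =ᵐ[μ] ψ ∘ T := fun ψ => Lp.coeFn_compMeasurePreserving ψ hmp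
  have hmean := U.tendsto_birkhoffAverage_orthogonalProjection
    (LinearIsometry.norm_toContinuousLinearMap_le _) φ
  set P := (U.eqLocus (1 : Lp ℝ 2 μ →L[ℝ] Lp ℝ 2 μ)).orthogonalProjectionOnto φ with hP
  -- Invariant functions are constant, and `φ` is orthogonal to constants.
  have hP0 : (P : Lp ℝ 2 μ) = 0 := by
    have hfix : U (P : Lp ℝ 2 μ) = P := P.2
    obtain ⟨c, hc⟩ := hT.ae_eq_const_of_ae_eq_comp_ae (g := (P : Lp ℝ 2 μ))
      (Lp.aestronglyMeasurable _) ((hU _).symm.trans (by rw [hfix]))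
    have horth : inner ℝ (P : Lp ℝ 2 μ) φ = 0 := by
      rw [L2.inner_def]
      have : (fun a => inner ℝ ((P : Lp ℝ 2 μ) a) (φ a)) =ᵐ[μ] fun a => c * (f a - m) := by
        filter_upwards [hc, hg.coeFn_toLp] with a ha hb
        rw [ha, hφ, hb]
        simp [mul_comm]
      rw [integral_congr_ae this, integral_const_mul,
        integral_sub (hf.integrable one_le_two) (integrable_const m)]
      simp [hm]
    have h2 : inner ℝ (P : Lp ℝ 2 μ) (P : Lp ℝ 2 μ) = inner ℝ (P : Lp ℝ 2 μ) φ := by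
      rw [← sub_eq_zero, ← inner_sub_right]
      have := Submodule.starProjection_inner_eq_zero
        (K := U.eqLocus (1 : Lp ℝ 2 μ →L[ℝ] Lp ℝ 2 μ)) φ P P.2
      rw [real_inner_comm, ← neg_sub, inner_neg_left, neg_eq_zero]
      exact this
    rw [horth] at h2
    exact inner_self_eq_zero.1 h2
  rw [hP0] at hmean
  have hmeas := tendstoInMeasure_of_tendsto_Lp hmean
  rw [tendstoInMeasure_iff_measureReal_norm] at hmeas
  have hlim := hmeas (r - m) (sub_pos.2 hr)
  have hiter : ∀ i : ℕ, (U^[i] φ : Lp ℝ 2 μ) =ᵐ[μ] fun x => f (T^[i] x) - m := by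
    intro i
    induction i with
    | zero => exact hg.coeFn_toLp
    | succ i ih =>
      rw [Function.iterate_succ_apply']
      refine (hU _).trans ?_
      filter_upwards [hmp.quasiMeasurePreserving.ae_eq_comp ih] with x hx
      rw [hx]
      simp
  have hsum : ∀ n : ℕ, (birkhoffAverage ℝ U _root_.id n φ : Lp ℝ 2 μ) =ᵐ[μ]
      fun x => (n : ℝ)⁻¹ * ∑ i ∈ Finset.range n, (f (T^[i] x) - m) := by
    intro n
    rw [birkhoffAverage, birkhoffSum]
    refine (Lp.coeFn_smul _ _).trans ?_
    have h1 : (↑↑(∑ i ∈ Finset.range n, _root_.id (U^[i] φ)) : Ω → ℝ) =ᵐ[μ]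
        ∑ i ∈ Finset.range n, ((U^[i] φ : Lp ℝ 2 μ) : Ω → ℝ) :=
      Lp.coeFn_finsetSum _ _
    have h2 := (ae_all_iff (ι := ℕ)).2 hiter
    filter_upwards [h1, h2] with x hx hy
    rw [Pi.smul_apply, hx, Finset.sum_apply, smul_eq_mul]
    simp only [hy]
  refine tendsto_of_tendsto_of_tendsto_of_le_of_le' tendsto_const_nhds hlim
    (Eventually.of_forall fun _ => measureReal_nonneg) ?_
  filter_upwards [eventually_gt_atTop 0] with n hn
  have hn' : (0 : ℝ) < n := by exact_mod_cast hn
  refine ENNReal.toReal_mono (measure_ne_top _ _) (measure_mono_ae ?_)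
  filter_upwards [hsum n, Lp.coeFn_zero ℝ 2 μ] with x hx h0
  intro (hlt : r * n < _)
  show r - m ≤ ‖_ - _‖
  rw [hx, h0, Finset.sum_sub_distrib]
  simp only [Finset.sum_const, Finset.card_range, nsmul_eq_mul, Pi.zero_apply, sub_zero]
  refine le_trans ?_ (le_abs_self _)
  rw [← mul_le_mul_iff_right₀ hn', mul_inv_cancel_left₀ hn'.ne']
  nlinarith

/-! ### Request processes -/

namespace IsRequestLaw

variable {α : ProbabilityMeasure (ℕ → ℕ)} {r : ℝ}

lemma lintegral_comp_eval (h : IsRequestLaw α r) (g : ℕ → ℝ≥0∞) (t : ℕ) :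
    ∫⁻ a, g (a t) ∂(α : Measure (ℕ → ℕ)) = ∫⁻ a, g (a 0) ∂(α : Measure (ℕ → ℕ)) := by
  induction t with
  | zero => rfl
  | succ t ih =>
    rw [← ih]
    exact h.ergodic.toMeasurePreserving.lintegral_comp (f := fun a : ℕ → ℕ => g (a t))
      ((measurable_of_countable g).comp (measurable_pi_apply t))

lemma exists_lintegral_sq_le (h : IsRequestLaw α r) :
    ∃ M : ℝ, ∀ t, ∫⁻ a, (a t : ℝ≥0∞) ^ 2 ∂(α : Measure (ℕ → ℕ)) ≤ ENNReal.ofReal M := by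
  obtain ⟨Amax, hA⟩ := h.second_moment
  refine ⟨Amax ^ 2, fun t => ?_⟩
  rw [h.lintegral_comp_eval (fun n => (n : ℝ≥0∞) ^ 2) t]
  simpa using hA 0 0

lemma lintegral_eval (h : IsRequestLaw α r) (t : ℕ) :
    ∫⁻ a, (a t : ℝ≥0∞) ∂(α : Measure (ℕ → ℕ)) = ENNReal.ofReal r := by
  rw [h.lintegral_comp_eval (fun n => (n : ℝ≥0∞)) t, ← h.rate,
    ofReal_integral_eq_lintegral_ofReal h.integrable (Eventually.of_forall fun a => by positivity)]
  simp

lemma memLp (h : IsRequestLaw α r) :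
    MemLp (fun a : ℕ → ℕ => (a 0 : ℝ)) 2 (α : Measure (ℕ → ℕ)) := by
  obtain ⟨M, hM⟩ := h.exists_lintegral_sq_le
  refine ⟨h.integrable.1, ?_⟩
  rw [eLpNorm_lt_top_iff_lintegral_rpow_enorm_lt_top (by simp) (by simp)]
  refine lt_of_le_of_lt (le_of_eq ?_) ((hM 0).trans_lt ENNReal.ofReal_lt_top)
  simp

lemma tendsto_measureReal_lt_sum (h : IsRequestLaw α r) {r' : ℝ} (hr : r < r') :
    Tendsto (fun n : ℕ => (α : Measure (ℕ → ℕ)).real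
      {a | r' * n < ∑ i ∈ Finset.range n, (a i : ℝ)}) atTop (𝓝 0) := by
  have hiter : ∀ (i : ℕ) (a : ℕ → ℕ),
      (fun (a : ℕ → ℕ) (t : ℕ) => a (t + 1))^[i] a = fun t => a (t + i) := by
    intro i
    induction i with
    | zero => intro a; rfl
    | succ i ih => intro a; rw [Function.iterate_succ_apply, ih]; funext t; congr 1
  simpa [hiter] using h.ergodic.tendsto_measureReal_lt_sum h.memLp (by rwa [h.rate])

end IsRequestLaw

/-- Every rate is the rate of a request process: independent requests, each slot receiving
`⌊r⌋` or `⌊r⌋ + 1` of them. -/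
lemma exists_isRequestLaw {r : ℝ} (hr : 0 ≤ r) :
    ∃ α : ProbabilityMeasure (ℕ → ℕ), IsRequestLaw α r := by
  set n := ⌊r⌋₊
  have hx : r - n ∈ Set.Icc (0 : ℝ) 1 :=
    ⟨sub_nonneg.2 (Nat.floor_le hr), by linarith [Nat.lt_floor_add_one r]⟩
  let μ : Measure ℕ := bernoulliMeasure (n + 1) n ⟨r - n, hx⟩
  have hμ : ∀ᵐ x ∂μ, x ≤ n + 1 := by
    rw [ae_iff]
    exact bernoulliMeasure_apply_of_notMem_of_notMem _ (by measurability) (by simp) (by simp)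
  have hmp := measurePreserving_eval_infinitePi (fun _ : ℕ => μ)
  have hb : ∀ t, ∀ᵐ a ∂(Measure.infinitePi fun _ : ℕ => μ), a t ≤ n + 1 := fun t =>
    (hmp t).quasiMeasurePreserving.ae hμ
  refine ⟨⟨Measure.infinitePi fun _ : ℕ => μ, inferInstance⟩,
    ergodic_shift_infinitePi μ, ?_, ?_, ?_⟩
  · change Integrable _ (Measure.infinitePi fun _ : ℕ => μ)
    refine Integrable.of_bound (C := n + 1)
      ((measurable_of_countable fun x : ℕ => (x : ℝ)).comp
        (measurable_pi_apply 0)).aestronglyMeasurable ?_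
    filter_upwards [hb 0] with a ha
    simpa using (by exact_mod_cast ha : (a 0 : ℝ) ≤ n + 1)
  · have h1 := (hmp 0).map_eq ▸ integral_map (hmp 0).measurable.aemeasurable
      (f := fun x : ℕ => (x : ℝ)) (measurable_of_countable _).aestronglyMeasurable
    refine h1.symm.trans ?_
    rw [integral_bernoulliMeasure]
    simp
    ring
  · refine ⟨n + 1, fun t h => ?_⟩
    rw [← setLIntegral_const]
    refine lintegral_mono_ae (ae_restrict_of_ae ?_)
    filter_upwards [hb t] with a ha
    rw [ENNReal.ofReal_pow (by positivity)]
    gcongr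
    rw [← ENNReal.ofReal_natCast]
    exact ENNReal.ofReal_le_ofReal (by exact_mod_cast ha)

/-! ### Independent coordinates -/

/-- A function that does not depend on one coordinate is independent of that coordinate. -/
lemma lintegral_mul_comp_eval_infinitePi {ι X : Type*} [MeasurableSpace X] (μ : ι → Measure X)
    [∀ i, IsProbabilityMeasure (μ i)] [DecidableEq ι] (i : ι) {f : (ι → X) → ℝ≥0∞}
    (hf : Measurable f) (hfi : ∀ b x, f (Function.update b i x) = f b) {g : X → ℝ≥0∞}
    (hg : Measurable g) :
    ∫⁻ b, f b * g (b i) ∂Measure.infinitePi μ =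
      (∫⁻ b, f b ∂Measure.infinitePi μ) * ∫⁻ x, g x ∂μ i := by
  let m : ι → MeasurableSpace (ι → X) := fun j =>
    MeasurableSpace.comap (fun a : ι → X => a j) inferInstance
  have hm : ∀ j, m j ≤ MeasurableSpace.pi := fun j => (measurable_pi_apply j).comap_le
  have hind : iIndep m (Measure.infinitePi μ) :=
    iIndepFun_infinitePi (P := μ) (X := fun _ x => x) (fun _ => measurable_id)
  have hindep := indep_iSup_of_disjoint hm hind
    (Set.disjoint_singleton_right.2 (by simp) : Disjoint {i}ᶜ {i})
  obtain ⟨x₀⟩ : Nonempty X := (μ i).nonempty_of_neZero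
  have hupd : Measurable[⨆ j ∈ ({i}ᶜ : Set ι), m j, MeasurableSpace.pi]
      fun b : ι → X => Function.update b i x₀ := by
    refine @measurable_pi_iff (ι → X) ι (fun _ => X) (⨆ j ∈ ({i}ᶜ : Set ι), m j) _ _ |>.2 ?_
    intro j
    by_cases hj : j = i
    · subst hj
      simp
    · simp only [Function.update_of_ne hj]
      refine Measurable.mono (comap_measurable fun a : ι → X => a j) ?_ le_rfl
      exact le_iSup₂_of_le (f := fun (j : ι) (_ : j ∈ ({i}ᶜ : Set ι)) => m j) j hj le_rfl
  have hf' : Measurable[⨆ j ∈ ({i}ᶜ : Set ι), m j] f := by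
    have := hf.comp hupd
    simpa only [Function.comp_def, hfi] using this
  have hg' : Measurable[⨆ j ∈ ({i} : Set ι), m j] fun b : ι → X => g (b i) := by
    refine Measurable.mono (hg.comp (comap_measurable fun a : ι → X => a i)) ?_ le_rfl
    exact le_iSup₂_of_le (f := fun (j : ι) (_ : j ∈ ({i} : Set ι)) => m j) i rfl le_rfl
  rw [lintegral_mul_eq_lintegral_mul_lintegral_of_independent_measurableSpace
    (iSup₂_le fun j _ => hm j) (iSup₂_le fun j _ => hm j) hindep hf' hg']
  congr 1
  exact (measurePreserving_eval_infinitePi μ i).lintegral_comp hg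

lemma ae_le_one_bernoulliMeasure (q : unitInterval) :
    ∀ᵐ x ∂bernoulliMeasure (1 : ℕ) 0 q, x ≤ 1 := by
  rw [ae_iff]
  exact bernoulliMeasure_apply_of_notMem_of_notMem _ (by measurability) (by simp) (by simp)

lemma lintegral_bernoulliMeasure_one_zero (q : unitInterval) :
    ∫⁻ x, (x : ℝ≥0∞) ∂bernoulliMeasure (1 : ℕ) 0 q = ENNReal.ofReal q := by
  have h := integral_bernoulliMeasure (1 : ℕ) 0 q (fun x => (x : ℝ))
  simp only [Nat.cast_one, Nat.cast_zero, smul_eq_mul, mul_one, mul_zero, add_zero] at h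
  have hint : Integrable (fun x : ℕ => (x : ℝ)) (bernoulliMeasure (1 : ℕ) 0 q) := by
    refine Integrable.of_bound (C := 1) (measurable_of_countable _).aestronglyMeasurable ?_
    filter_upwards [ae_le_one_bernoulliMeasure q] with x hx
    simpa using hx
  rw [← h, ofReal_integral_eq_lintegral_ofReal hint (Eventually.of_forall fun x => by positivity)]
  simp

/-- Chebyshev's inequality for sums of independent Bernoulli variables. -/
lemma measureReal_sum_bernoulli_lt_le {ι : Type*} (p : ι → unitInterval) (S : Finset ι) {c : ℝ}
    (hc : 0 < c) :
    (Measure.infinitePi fun i => bernoulliMeasure (1 : ℕ) 0 (p i)).real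
      {b | ∑ i ∈ S, (b i : ℝ) < ∑ i ∈ S, (p i : ℝ) - c} ≤ S.card / c ^ 2 := by
  set μ := fun i => bernoulliMeasure (1 : ℕ) 0 (p i) with hμ
  set P := Measure.infinitePi μ with hP
  have hmeas : ∀ i, Measurable fun b : ι → ℕ => (b i : ℝ) := fun i =>
    (measurable_of_countable fun x : ℕ => (x : ℝ)).comp (measurable_pi_apply i)
  have hbd : ∀ i, ∀ᵐ b ∂P, (b i : ℝ) ∈ Set.Icc (0 : ℝ) 1 := by
    intro i
    filter_upwards [(measurePreserving_eval_infinitePi μ i).quasiMeasurePreserving.ae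
      (ae_le_one_bernoulliMeasure (p i))] with b hb
    exact ⟨by positivity, by exact_mod_cast hb⟩
  have hLp : ∀ i, MemLp (fun b : ι → ℕ => (b i : ℝ)) 2 P := fun i =>
    memLp_of_bounded (hbd i) (hmeas i).aestronglyMeasurable 2
  have hmean : ∀ i, ∫ b, (b i : ℝ) ∂P = p i := by
    intro i
    have h1 := (measurePreserving_eval_infinitePi μ i).map_eq ▸
      integral_map (μ := P) (measurePreserving_eval_infinitePi μ i).measurable.aemeasurable
      (f := fun x : ℕ => (x : ℝ)) (measurable_of_countable _).aestronglyMeasurable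
    refine h1.symm.trans ?_
    rw [hμ, integral_bernoulliMeasure]
    simp
  have hind : iIndepFun (fun i (b : ι → ℕ) => (b i : ℝ)) P :=
    iIndepFun_infinitePi (P := μ) (X := fun _ (x : ℕ) => (x : ℝ))
      (fun _ => measurable_of_countable _)
  have hvar : variance (∑ i ∈ S, fun b : ι → ℕ => (b i : ℝ)) P ≤ S.card := by
    rw [IndepFun.variance_sum (fun i _ => hLp i) (fun i _ j _ hij => hind.indepFun hij)]
    refine (Finset.sum_le_card_nsmul S _ 1 fun i _ => ?_).trans (by simp)
    exact (variance_le_sq_of_bounded (hbd i) (hmeas i).aemeasurable).trans (by norm_num)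
  have hmeanS : ∫ b, (∑ i ∈ S, fun b : ι → ℕ => (b i : ℝ)) b ∂P = ∑ i ∈ S, (p i : ℝ) := by
    simp only [Finset.sum_apply]
    rw [integral_finsetSum _ fun i _ => (hLp i).integrable one_le_two]
    simp [hmean]
  have hcheb := meas_ge_le_variance_div_sq (memLp_finsetSum' S fun i _ => hLp i) hc (μ := P)
  rw [hmeanS] at hcheb
  refine ENNReal.toReal_le_of_le_ofReal (by positivity) (le_trans (measure_mono ?_)
    (hcheb.trans (ENNReal.ofReal_le_ofReal (by gcongr))))
  intro b (hb : ∑ i ∈ S, (b i : ℝ) < ∑ i ∈ S, (p i : ℝ) - c)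
  show c ≤ |_|
  rw [Finset.sum_apply, abs_sub_comm]
  exact le_trans (by linarith) (le_abs_self _)

/-- Prescribed frequencies are realised by some sequence: almost every sequence of independent
draws does it, by the strong law of large numbers. -/
lemma exists_seq_tendsto_frequency {ι : Type*} [Fintype ι] [DecidableEq ι] (θ : ι → ℝ)
    (h0 : ∀ e, 0 ≤ θ e) (h1 : ∑ e, θ e ≤ 1) :
    ∃ g : ℕ → Option ι, ∀ e, Tendsto
      (fun n : ℕ => (((Finset.range n).filter fun s => g s = some e).card : ℝ) / n)
      atTop (𝓝 (θ e)) := by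
  let w : Option ι → ℝ≥0∞ := fun o => ENNReal.ofReal (o.elim (1 - ∑ e, θ e) θ)
  have hw : ∑ o, w o = 1 := by
    rw [← ENNReal.ofReal_sum_of_nonneg]
    · simp [Fintype.sum_option]
    · rintro (_ | e) _
      · simpa using h1
      · exact h0 e
  let _ : MeasurableSpace (Option ι) := ⊤
  let μ : Measure (Option ι) := (PMF.ofFintype w hw).toMeasure
  let P : Measure (ℕ → Option ι) := Measure.infinitePi fun _ => μ
  have key : ∀ e, ∀ᵐ a ∂P, Tendsto
      (fun n : ℕ => (((Finset.range n).filter fun s => a s = some e).card : ℝ) / n)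
      atTop (𝓝 (θ e)) := by
    intro e
    let f : Option ι → ℝ := fun o => if o = some e then 1 else 0
    have hf : Measurable f := measurable_of_countable _
    have hmp := measurePreserving_eval_infinitePi (fun _ : ℕ => μ)
    have hslln := strong_law_ae_real (μ := P) (fun n a => f (a n))
      (Integrable.of_bound (C := 1) (hf.comp (measurable_pi_apply 0)).aestronglyMeasurable
        (Eventually.of_forall fun a => by simp only [f]; split_ifs <;> simp))
      (fun i j hij => (iIndepFun_infinitePi (P := fun _ : ℕ => μ) (X := fun _ => f)
        (fun _ => hf)).indepFun hij)
      (fun i => ⟨(hf.comp (measurable_pi_apply i)).aemeasurable,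
        (hf.comp (measurable_pi_apply 0)).aemeasurable, by
          rw [← Function.comp_def f, ← Function.comp_def f,
            ← Measure.map_map hf (measurable_pi_apply i),
            ← Measure.map_map hf (measurable_pi_apply 0)]
          exact congrArg (Measure.map f) ((hmp i).map_eq.trans (hmp 0).map_eq.symm)⟩)
    have hint : ∫ a, f (a 0) ∂P = θ e := by
      have h2 := (hmp 0).map_eq ▸ integral_map (μ := P) (hmp 0).measurable.aemeasurable
        (f := f) hf.aestronglyMeasurable
      refine h2.symm.trans ?_
      have hfe : f = Set.indicator {some e} 1 := by
        funext o
        simp [f, Set.indicator]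
      rw [hfe, integral_indicator_one (by trivial), measureReal_def,
        PMF.toMeasure_apply_singleton _ _ (by trivial)]
      simp [w, h0 e]
    rw [hint] at hslln
    filter_upwards [hslln] with a ha
    simpa [f, Finset.sum_boole] using ha
  obtain ⟨g, hg⟩ := (ae_all_iff.2 key).exists
  exact ⟨g, hg⟩

/-! ### Rate matrices and flows -/

section Flows

variable {K : ℕ}

/-- The rate matrix with the given rates of the pairs. -/
def rateMatrix (φ : UserPair K → ℝ) : Matrix (Fin K) (Fin K) ℝ :=
  Matrix.of fun i j => if h : i ≠ j then φ (userPair i j h) else 0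

lemma rateMatrix_of_ne (φ : UserPair K → ℝ) {i j : Fin K} (h : i ≠ j) :
    rateMatrix φ i j = φ (userPair i j h) := by
  simp [rateMatrix, h]

@[simp] lemma rateMatrix_self (φ : UserPair K → ℝ) (i : Fin K) : rateMatrix φ i i = 0 := by
  simp [rateMatrix]

lemma userPair_comm {i j : Fin K} (h : i ≠ j) : userPair i j h = userPair j i h.symm :=
  Subtype.ext Sym2.eq_swap

lemma exists_eq_userPair (e : UserPair K) : ∃ i j, ∃ h : i ≠ j, e = userPair i j h := by
  obtain ⟨⟨i, j⟩, he⟩ := e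
  exact ⟨i, j, fun h => he (Sym2.mk_isDiag_iff.2 h), rfl⟩

lemma isRateMatrix_rateMatrix {φ : UserPair K → ℝ} (hφ : ∀ e, 0 ≤ φ e) :
    IsRateMatrix (rateMatrix φ) where
  symm i j := by
    by_cases h : i = j
    · rw [h]
    · rw [rateMatrix_of_ne φ h, rateMatrix_of_ne φ (Ne.symm h), userPair_comm]
  diag := rateMatrix_self φ
  nonneg i j := by
    by_cases h : i = j
    · simp [h]
    · rw [rateMatrix_of_ne φ h]
      exact hφ _

lemma IsRateMatrix.exists_eq_rateMatrix {lam : Matrix (Fin K) (Fin K) ℝ} (h : IsRateMatrix lam) :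
    ∃ φ : UserPair K → ℝ, (∀ e, 0 ≤ φ e) ∧ lam = rateMatrix φ := by
  refine ⟨fun e => Sym2.lift ⟨fun i j => lam i j, h.symm⟩ e.1, ?_, ?_⟩
  · intro e
    obtain ⟨i, j, hij, rfl⟩ := exists_eq_userPair e
    exact h.nonneg i j
  · ext i j
    by_cases hij : i = j
    · rw [hij, rateMatrix_self, h.diag]
    · rw [rateMatrix_of_ne _ hij]
      rfl

lemma sum_rateMatrix_apply (φ : UserPair K → ℝ) (j : Fin K) :
    ∑ i, rateMatrix φ i j = ∑ e : UserPair K with j ∈ e.1, φ e := by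
  have h : ∑ i, rateMatrix φ i j = ∑ i with i ≠ j, rateMatrix φ i j := by
    refine (Finset.sum_subset (Finset.subset_univ _) fun i _ hi => ?_).symm
    have : i = j := by simpa using hi
    simp [this]
  rw [h]
  refine Finset.sum_bij (fun i hi => userPair i j (Finset.mem_filter.1 hi).2) ?_ ?_ ?_ ?_
  · intro i hi
    simp [userPair]
  · intro i hi i' hi' hii
    exact Sym2.congr_left.1 (congrArg Subtype.val hii)
  · intro e he
    obtain ⟨i, k, hik, rfl⟩ := exists_eq_userPair e
    rcases Sym2.mem_iff.1 (Finset.mem_filter.1 he).2 with rfl | rfl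
    · exact ⟨k, by simp [hik.symm], userPair_comm _⟩
    · exact ⟨i, by simp [hik], rfl⟩
  · intro i hi
    exact rateMatrix_of_ne φ _

lemma sum_lt_rateMatrix (φ : UserPair K → ℝ) :
    ∑ i, ∑ j with i < j, rateMatrix φ i j = ∑ e, φ e := by
  refine (Finset.sum_sigma' Finset.univ (fun i => Finset.univ.filter (i < ·))
    (fun i j => rateMatrix φ i j)).trans ?_
  refine Finset.sum_bij (fun x hx => userPair x.1 x.2
    (Finset.mem_filter.1 (Finset.mem_sigma.1 hx).2).2.ne) ?_ ?_ ?_ ?_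
  · intro x hx
    exact Finset.mem_univ _
  · rintro ⟨i, j⟩ hx ⟨i', j'⟩ hx' h
    have h1 : i < j := by simpa using hx
    have h2 : i' < j' := by simpa using hx'
    rcases Sym2.eq_iff.1 (congrArg Subtype.val h) with ⟨h3, h4⟩ | ⟨h3, h4⟩
    · simp only at h3 h4
      rw [h3, h4]
    · simp only at h3 h4
      omega
  · intro e _
    obtain ⟨i, j, hij, rfl⟩ := exists_eq_userPair e
    rcases lt_or_gt_of_ne hij with h | h
    · exact ⟨⟨i, j⟩, by simp [h], rfl⟩
    · exact ⟨⟨j, i⟩, by simp [h], userPair_comm _⟩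
  · intro x hx
    exact rateMatrix_of_ne φ _

/-- Long-run rates of attempted swaps that respect the generation rates of EPR pairs and the limit
on the number of swaps per slot. -/
structure IsFlow (p : Fin K → unitInterval) (W : ℕ∞) (φ : UserPair K → ℝ) : Prop where
  nonneg : ∀ e, 0 ≤ φ e
  node_le : ∀ j, ∑ e : UserPair K with j ∈ e.1, φ e ≤ (p j : ℝ)
  total_le : ENNReal.ofReal (∑ e, φ e) ≤ (W : ℝ≥0∞)

variable {p : Fin K → unitInterval} {q : unitInterval} {W : ℕ∞}

lemma rateMatrix_mem_flowRegion {l : UserPair K → ℝ} (hl : ∀ e, 0 ≤ l e) :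
    rateMatrix l ∈ flowRegion p q W ↔ ∃ φ, IsFlow p W φ ∧ ∀ e, l e ≤ q * φ e := by
  constructor
  · rintro ⟨-, f, hf, hp, hW, hq⟩
    obtain ⟨φ, hφ, rfl⟩ := hf.exists_eq_rateMatrix
    refine ⟨φ, ⟨hφ, fun j => sum_rateMatrix_apply φ j ▸ hp j, sum_lt_rateMatrix φ ▸ hW⟩, ?_⟩
    intro e
    obtain ⟨i, j, hij, rfl⟩ := exists_eq_userPair e
    simpa only [rateMatrix_of_ne _ hij] using hq i j
  · rintro ⟨φ, hφ, hq⟩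
    refine ⟨isRateMatrix_rateMatrix hl, rateMatrix φ, isRateMatrix_rateMatrix hφ.nonneg,
      fun j => (sum_rateMatrix_apply φ j).trans_le (hφ.node_le j),
      (sum_lt_rateMatrix φ).symm ▸ hφ.total_le, fun i j => ?_⟩
    by_cases hij : i = j
    · simp [hij]
    · simpa only [rateMatrix_of_ne _ hij] using hq _

lemma IsFlow.le_node {φ : UserPair K → ℝ} (h : IsFlow p W φ) {e : UserPair K} {j : Fin K}
    (hj : j ∈ e.1) : φ e ≤ p j :=
  (Finset.single_le_sum (f := φ) (fun e _ => h.nonneg e) (by simpa using hj)).trans (h.node_le j)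

lemma IsFlow.le_one {φ : UserPair K → ℝ} (h : IsFlow p W φ) (e : UserPair K) : φ e ≤ 1 := by
  obtain ⟨i, j, hij, rfl⟩ := exists_eq_userPair e
  exact (h.le_node (Sym2.mem_mk_left i j)).trans (p i).2.2

lemma isCompact_setOf_isFlow (p : Fin K → unitInterval) (W : ℕ∞) :
    IsCompact {φ : UserPair K → ℝ | IsFlow p W φ} := by
  refine (isCompact_Icc (a := (0 : UserPair K → ℝ)) (b := 1)).of_isClosed_subset ?_
    fun φ hφ => ⟨hφ.nonneg, hφ.le_one⟩
  have : {φ : UserPair K → ℝ | IsFlow p W φ} = {φ | ∀ e, 0 ≤ φ e} ∩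
      ({φ | ∀ j, ∑ e : UserPair K with j ∈ e.1, φ e ≤ (p j : ℝ)} ∩
        {φ | ENNReal.ofReal (∑ e, φ e) ≤ (W : ℝ≥0∞)}) := by
    ext φ
    exact ⟨fun h => ⟨h.1, h.2, h.3⟩, fun h => ⟨h.1, h.2.1, h.2.2⟩⟩
  rw [this]
  refine IsClosed.inter ?_ (IsClosed.inter ?_ ?_)
  · simp only [Set.ofPred_forall]
    exact isClosed_iInter fun e => isClosed_le (by fun_prop) (by fun_prop)
  · simp only [Set.ofPred_forall]
    exact isClosed_iInter fun j => isClosed_le (by fun_prop) (by fun_prop)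
  · exact isClosed_le (ENNReal.continuous_ofReal.comp (by fun_prop)) (by fun_prop)

/-- Rates that are served up to every positive error are served exactly. -/
lemma exists_isFlow_of_approx {l : UserPair K → ℝ}
    (h : ∀ η : ℝ, 0 < η → ∃ φ, IsFlow p W φ ∧ ∀ e, l e - η ≤ q * φ e) :
    ∃ φ, IsFlow p W φ ∧ ∀ e, l e ≤ q * φ e := by
  choose φ hφ hl using fun n : ℕ => h (1 / ((n : ℝ) + 1)) (by positivity)
  obtain ⟨ψ, hψ, s, hs, hlim⟩ := (isCompact_setOf_isFlow p W).tendsto_subseq hφ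
  refine ⟨ψ, hψ, fun e => ?_⟩
  have h1 : Tendsto (fun n => l e - 1 / ((s n : ℝ) + 1)) atTop (𝓝 (l e - 0)) :=
    tendsto_const_nhds.sub (tendsto_one_div_add_atTop_nhds_zero_nat.comp hs.tendsto_atTop)
  have h2 : Tendsto (fun n => (q : ℝ) * φ (s n) e) atTop (𝓝 (q * ψ e)) :=
    ((tendsto_pi_nhds.1 hlim) e).const_mul _
  rw [sub_zero] at h1
  exact le_of_tendsto_of_tendsto' h1 h2 fun n => hl (s n) e

lemma isClosed_flowRegion (p : Fin K → unitInterval) (q : unitInterval) (W : ℕ∞) :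
    IsClosed (flowRegion p q W) := by
  refine isClosed_of_closure_subset fun lam hlam => ?_
  have hc : ∀ i j, Continuous fun M : Matrix (Fin K) (Fin K) ℝ => M i j := fun i j =>
    continuous_id.matrix_elem i j
  have hrate : IsRateMatrix lam := by
    constructor
    · intro i j
      exact closure_minimal (t := {M : Matrix (Fin K) (Fin K) ℝ | M i j = M j i})
        (fun M hM => hM.1.symm i j)
        (isClosed_eq (hc i j) (hc j i)) hlam
    · intro i
      exact closure_minimal (t := {M : Matrix (Fin K) (Fin K) ℝ | M i i = 0})
        (fun M hM => hM.1.diag i)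
        (isClosed_eq (hc i i) continuous_const) hlam
    · intro i j
      exact closure_minimal (t := {M : Matrix (Fin K) (Fin K) ℝ | 0 ≤ M i j})
        (fun M hM => hM.1.nonneg i j)
        (isClosed_le continuous_const (hc i j)) hlam
  obtain ⟨l, hl, rfl⟩ := hrate.exists_eq_rateMatrix
  refine (rateMatrix_mem_flowRegion hl).2 (exists_isFlow_of_approx fun η hη => ?_)
  have hopen : IsOpen {M : Matrix (Fin K) (Fin K) ℝ | ∀ i j, rateMatrix l i j - η < M i j} := by
    simp only [Set.ofPred_forall]
    exact isOpen_iInter_of_finite fun i => isOpen_iInter_of_finite fun j =>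
      isOpen_lt continuous_const (hc i j)
  obtain ⟨M, hM, hMf⟩ := mem_closure_iff.1 hlam _ hopen fun i j => sub_lt_self _ hη
  obtain ⟨l', hl', rfl⟩ := hMf.1.exists_eq_rateMatrix
  obtain ⟨φ, hφ, hq⟩ := (rateMatrix_mem_flowRegion hl').1 hMf
  refine ⟨φ, hφ, fun e => le_trans ?_ (hq e)⟩
  obtain ⟨i, j, hij, rfl⟩ := exists_eq_userPair e
  simpa only [rateMatrix_of_ne _ hij] using (hM i j).le

end Flows

/-! ### Pathwise accounting -/

section Paths

variable {K : ℕ} {W : ℕ∞} (π : Protocol K W) (ω : Sample K π.Seed)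

/-- The state of the switch at time `t`. -/
def stateAt (t : ℕ) : SwitchState K := History.state (runHistory π ω t)

/-- The number of swaps attempted for the pair `e` in slot `t`. -/
def attemptsAt (t : ℕ) (e : UserPair K) : ℕ := π.attempts (runHistory π ω t) ω.2.2.2 e

/-- The number of swaps that succeed for the pair `e` in slot `t`. -/
def successesAt (t : ℕ) (e : UserPair K) : ℕ :=
  ∑ n ∈ Finset.range (attemptsAt π ω t e), ω.2.2.1 (e, t, n)

lemma stateAt_succ_U (t : ℕ) (e : UserPair K) : (stateAt π ω (t + 1)).U e =
    ((stateAt π ω t).U e - ((stateAt π ω t).E e + successesAt π ω t e)) + ω.1 e t := rfl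

lemma stateAt_succ_E (t : ℕ) (e : UserPair K) : (stateAt π ω (t + 1)).E e =
    ((stateAt π ω t).E e + successesAt π ω t e) - (stateAt π ω t).U e := rfl

lemma stateAt_succ_E₀ (t : ℕ) (j : Fin K) : (stateAt π ω (t + 1)).E₀ j =
    ((stateAt π ω t).E₀ j - ∑ e : UserPair K with j ∈ e.1, attemptsAt π ω t e) + ω.2.1 (j, t) := rfl

lemma length_runHistory (t : ℕ) : (runHistory π ω t).length = t := by
  induction t with
  | zero => rfl
  | succ t ih => simpa [runHistory] using ih

lemma stateAt_balance (t : ℕ) (e : UserPair K) :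
    (stateAt π ω t).U e + ∑ s ∈ Finset.range t, successesAt π ω s e =
      (stateAt π ω t).E e + ∑ s ∈ Finset.range t, ω.1 e s := by
  induction t with
  | zero => rfl
  | succ t ih =>
    rw [stateAt_succ_U, stateAt_succ_E, Finset.sum_range_succ, Finset.sum_range_succ]
    omega

/-- EPR pairs between end nodes are never lost, so once the successful swaps outnumber the requests
only the requests of the last slot can be pending. -/
lemma pendingRequests_succ_le (t : ℕ) (e : UserPair K)
    (h : ∑ s ∈ Finset.range (t + 1), ω.1 e s ≤
      ∑ s ∈ Finset.range (t + 1), successesAt π ω s e) :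
    pendingRequests π e (t + 1) ω ≤ ω.1 e t := by
  change (stateAt π ω (t + 1)).U e ≤ _
  have := stateAt_balance π ω t e
  rw [stateAt_succ_U]
  rw [Finset.sum_range_succ, Finset.sum_range_succ] at h
  omega

lemma sum_arrivals_le (t : ℕ) (e : UserPair K) : ∑ s ∈ Finset.range t, ω.1 e s ≤
    pendingRequests π e t ω + ∑ s ∈ Finset.range t, successesAt π ω s e := by
  have := stateAt_balance π ω t e
  change _ ≤ (stateAt π ω t).U e + _
  omega

lemma pendingRequests_le_sum (t : ℕ) (e : UserPair K) :
    pendingRequests π e t ω ≤ ∑ s ∈ Finset.range t, ω.1 e s := by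
  change (stateAt π ω t).U e ≤ _
  induction t with
  | zero => exact le_rfl
  | succ t ih =>
    rw [stateAt_succ_U, Finset.sum_range_succ]
    omega

lemma stored_add_attempts (t : ℕ) (j : Fin K) : (stateAt π ω t).E₀ j +
    ∑ s ∈ Finset.range t, ∑ e : UserPair K with j ∈ e.1, attemptsAt π ω s e =
      ∑ s ∈ Finset.range t, ω.2.1 (j, s) := by
  induction t with
  | zero => rfl
  | succ t ih =>
    have h := π.attempts_le_stored (runHistory π ω t) ω.2.2.2 j
    change ∑ e : UserPair K with j ∈ e.1, attemptsAt π ω t e ≤ (stateAt π ω t).E₀ j at h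
    rw [stateAt_succ_E₀, Finset.sum_range_succ, Finset.sum_range_succ]
    omega

end Paths

/-! ### Marginals of the law of the switch -/

section Marginals

variable {K : ℕ} {W : ℕ∞} (p : Fin K → unitInterval) (q : unitInterval) (π : Protocol K W)
  (α : UserPair K → ProbabilityMeasure (ℕ → ℕ))

/-- The law of the generation of EPR pairs. -/
noncomputable def generationLaw (p : Fin K → unitInterval) : Measure (Fin K × ℕ → ℕ) :=
  Measure.infinitePi fun x => bernoulliMeasure (1 : ℕ) 0 (p x.1)

/-- The law of the swap outcomes. -/
noncomputable def outcomeLaw (K : ℕ) (q : unitInterval) : Measure (UserPair K × ℕ × ℕ → ℕ) :=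
  Measure.infinitePi fun _ => bernoulliMeasure (1 : ℕ) 0 q

instance : IsProbabilityMeasure (generationLaw p) := by
  unfold generationLaw; infer_instance

instance : IsProbabilityMeasure (outcomeLaw K q) := by
  unfold outcomeLaw; infer_instance

lemma switchLaw_eq : switchLaw p q π α =
    (Measure.pi fun e => (α e : Measure (ℕ → ℕ))).prod
      ((generationLaw p).prod ((outcomeLaw K q).prod (π.seedLaw : Measure π.Seed))) := rfl

instance : IsProbabilityMeasure (switchLaw p q π α) := by
  rw [switchLaw_eq]; infer_instance

lemma measurePreserving_arrivals (e : UserPair K) :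
    MeasurePreserving (fun ω : Sample K π.Seed => ω.1 e) (switchLaw p q π α)
      (α e : Measure (ℕ → ℕ)) :=
  (measurePreserving_eval (fun e => (α e : Measure (ℕ → ℕ))) e).comp measurePreserving_fst

lemma measurePreserving_generation :
    MeasurePreserving (fun ω : Sample K π.Seed => ω.2.1) (switchLaw p q π α) (generationLaw p) :=
  (measurePreserving_fst (μ := generationLaw p)
    (ν := (outcomeLaw K q).prod (π.seedLaw : Measure π.Seed))).comp
    (measurePreserving_snd (μ := Measure.pi fun e => (α e : Measure (ℕ → ℕ))))

lemma measurePreserving_outcomes :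
    MeasurePreserving (fun ω : Sample K π.Seed => ω.2.2.1) (switchLaw p q π α)
      (outcomeLaw K q) :=
  (measurePreserving_fst (μ := outcomeLaw K q) (ν := (π.seedLaw : Measure π.Seed))).comp
    ((measurePreserving_snd (μ := generationLaw p)).comp
      (measurePreserving_snd (μ := Measure.pi fun e => (α e : Measure (ℕ → ℕ)))))

lemma measurePreserving_eval_generation (x : Fin K × ℕ) :
    MeasurePreserving (fun c : Fin K × ℕ → ℕ => c x) (generationLaw p)
      (bernoulliMeasure (1 : ℕ) 0 (p x.1)) :=
  measurePreserving_eval_infinitePi (fun x : Fin K × ℕ => bernoulliMeasure (1 : ℕ) 0 (p x.1)) x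

lemma ae_outcomes_le_one : ∀ᵐ ω ∂switchLaw p q π α, ∀ x, ω.2.2.1 x ≤ 1 := by
  have h : ∀ᵐ b ∂outcomeLaw K q, ∀ x, b x ≤ 1 := by
    rw [ae_all_iff]
    intro x
    exact (measurePreserving_eval_infinitePi (fun _ : UserPair K × ℕ × ℕ =>
      bernoulliMeasure (1 : ℕ) 0 q) x).quasiMeasurePreserving.ae (ae_le_one_bernoulliMeasure q)
  exact (measurePreserving_outcomes p q π α).quasiMeasurePreserving.ae h

end Marginals

/-! ### Serving the pairs on a fixed schedule -/

section Schedule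

variable {K : ℕ} {W : ℕ∞}

open Classical in
/-- The protocol that attempts `w` swaps in slot `t` for the pair `g t`, provided that both ends of
this pair have `w` EPR pairs stored with the switch, and none otherwise. It uses no randomness. -/
noncomputable def scheduledProtocol (g : ℕ → Option (UserPair K)) (w : ℕ) (hw : (w : ℕ∞) ≤ W) :
    Protocol K W where
  Seed := Unit
  seedLaw := ⟨Measure.dirac (), inferInstance⟩
  attempts h _ e :=
    if g h.length = some e ∧ ∀ j ∈ e.1, w ≤ (History.state h).E₀ j then w else 0
  measurable_attempts _ := measurable_const
  attempts_le_stored h _ j := by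
    by_cases hex : ∃ e : UserPair K, j ∈ e.1 ∧
        g h.length = some e ∧ ∀ j ∈ e.1, w ≤ (History.state h).E₀ j
    · obtain ⟨e, hje, hge, hst⟩ := hex
      refine le_trans (le_of_eq ?_) (hst j hje)
      rw [Finset.sum_eq_single_of_mem e (by simpa using hje)]
      · exact if_pos ⟨hge, hst⟩
      · intro e' _ hne
        exact if_neg fun h' => hne (Option.some_injective _ (h'.1.symm.trans hge))
    · refine le_trans (le_of_eq (Finset.sum_eq_zero fun e he => if_neg fun h' => ?_))
        (Nat.zero_le _)
      exact hex ⟨e, (Finset.mem_filter.1 he).2, h'⟩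
  attempts_le_limit h _ := by
    refine le_trans (Nat.cast_le.2 ?_) hw
    rcases hg : g h.length with _ | e
    · simp
    · rw [Finset.sum_eq_single e]
      · split_ifs <;> simp
      · intro e' _ hne
        exact if_neg fun h' => hne (Option.some_injective _ h'.1.symm)
      · simp

/-- The number of slots before time `t` in which the schedule `g` serves the pair `e`. -/
def scheduledSlots (g : ℕ → Option (UserPair K)) (e : UserPair K) (t : ℕ) : Finset ℕ :=
  (Finset.range t).filter fun s => g s = some e

/-- Too few EPR pairs are generated with some end of `e` before time `t` for `w` of them to be
stored, even if every scheduled swap has been attempted. -/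
def shortage (g : ℕ → Option (UserPair K)) (w : ℕ) (e : UserPair K) (t : ℕ) :
    Set (Fin K × ℕ → ℕ) :=
  {c | ∃ j ∈ e.1, ∑ s ∈ Finset.range t, c (j, s) <
    w + w * ∑ e' : UserPair K with j ∈ e'.1, (scheduledSlots g e' t).card}

variable (g : ℕ → Option (UserPair K)) (w : ℕ) (hw : (w : ℕ∞) ≤ W)
  (ω : Sample K (scheduledProtocol g w hw).Seed)

lemma attemptsAt_scheduledProtocol_le (t : ℕ) (e : UserPair K) :
    attemptsAt (scheduledProtocol g w hw) ω t e ≤ if g t = some e then w else 0 := by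
  classical
  have h : attemptsAt (scheduledProtocol g w hw) ω t e =
      if g (runHistory (scheduledProtocol g w hw) ω t).length = some e ∧
        ∀ j ∈ e.1, w ≤ (stateAt (scheduledProtocol g w hw) ω t).E₀ j then w else 0 := rfl
  rw [h, length_runHistory]
  split_ifs with h1 h2
  · exact le_rfl
  · exact absurd h1.1 h2
  all_goals exact Nat.zero_le _

lemma sum_attemptsAt_scheduledProtocol_le (t : ℕ) (e : UserPair K) :
    ∑ s ∈ Finset.range t, attemptsAt (scheduledProtocol g w hw) ω s e ≤
      w * (scheduledSlots g e t).card := by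
  refine (Finset.sum_le_sum fun s _ => attemptsAt_scheduledProtocol_le g w hw ω s e).trans ?_
  rw [← Finset.sum_filter, Finset.sum_const, smul_eq_mul, mul_comm]
  rfl

lemma attemptsAt_scheduledProtocol {t : ℕ} {e : UserPair K} (hg : g t = some e)
    (h : ω.2.1 ∉ shortage g w e t) : attemptsAt (scheduledProtocol g w hw) ω t e = w := by
  have hst : ∀ j ∈ e.1, w ≤ (stateAt (scheduledProtocol g w hw) ω t).E₀ j := by
    intro j hj
    have h1 : ¬ (∑ s ∈ Finset.range t, ω.2.1 (j, s) <
      w + w * ∑ e' : UserPair K with j ∈ e'.1, (scheduledSlots g e' t).card) :=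
      fun hlt => h ⟨j, hj, hlt⟩
    have h2 := stored_add_attempts (scheduledProtocol g w hw) ω t j
    have h3 : ∑ s ∈ Finset.range t, ∑ e' : UserPair K with j ∈ e'.1,
        attemptsAt (scheduledProtocol g w hw) ω s e' ≤
        w * ∑ e' : UserPair K with j ∈ e'.1, (scheduledSlots g e' t).card := by
      rw [Finset.sum_comm, Finset.mul_sum]
      exact Finset.sum_le_sum fun e' _ => sum_attemptsAt_scheduledProtocol_le g w hw ω t e'
    omega
  exact if_pos ⟨by rw [length_runHistory, hg], hst⟩

/-- Up to slots with a shortage, every scheduled swap is attempted. -/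
lemma sum_scheduled_outcomes_le (hb : ∀ x, ω.2.2.1 x ≤ 1) (t : ℕ) (e : UserPair K) :
    (∑ s ∈ scheduledSlots g e t, ∑ n ∈ Finset.range w, (ω.2.2.1 (e, s, n) : ℝ)) ≤
      (∑ s ∈ Finset.range t, (successesAt (scheduledProtocol g w hw) ω s e : ℝ)) +
        w * ∑ s ∈ Finset.range t, (shortage g w e s).indicator 1 ω.2.1 := by
  rw [scheduledSlots, Finset.sum_filter, Finset.mul_sum, ← Finset.sum_add_distrib]
  refine Finset.sum_le_sum fun s _ => ?_
  split_ifs with hg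
  · by_cases hD : ω.2.1 ∈ shortage g w e s
    · rw [Set.indicator_of_mem hD, Pi.one_apply, mul_one]
      have : ∑ n ∈ Finset.range w, (ω.2.2.1 (e, s, n) : ℝ) ≤ w := by
        refine (Finset.sum_le_card_nsmul _ _ 1 fun n _ => ?_).trans (by simp)
        exact_mod_cast hb _
      linarith [Nat.cast_nonneg (α := ℝ) (successesAt (scheduledProtocol g w hw) ω s e)]
    · rw [Set.indicator_of_notMem hD, mul_zero, add_zero, successesAt,
        attemptsAt_scheduledProtocol g w hw ω hg hD]
      push_cast
      exact le_rfl
  · have : 0 ≤ (shortage g w e s).indicator (1 : (Fin K × ℕ → ℕ) → ℝ) ω.2.1 :=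
      Set.indicator_nonneg (fun _ _ => zero_le_one) _
    positivity

end Schedule

/-! ### Stability under a schedule -/

/-- If the probabilities of the events `D s` tend to zero, then with high probability only a small
fraction of these events occur. -/
lemma tendsto_measureReal_le_sum_indicator {Ω : Type*} [MeasurableSpace Ω] {μ : Measure Ω}
    [IsProbabilityMeasure μ] {D : ℕ → Set Ω} (hD : ∀ s, MeasurableSet (D s))
    (h : Tendsto (fun s => μ.real (D s)) atTop (𝓝 0)) {κ : ℝ} (hκ : 0 < κ) :
    Tendsto (fun t : ℕ => μ.real {x | κ * t ≤ ∑ s ∈ Finset.range t, (D s).indicator 1 x})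
      atTop (𝓝 0) := by
  have hc := h.cesaro.const_mul κ⁻¹
  rw [mul_zero] at hc
  refine tendsto_of_tendsto_of_tendsto_of_le_of_le' tendsto_const_nhds hc
    (Eventually.of_forall fun _ => measureReal_nonneg) ?_
  filter_upwards [eventually_gt_atTop 0] with t ht
  have ht' : (0 : ℝ) < t := by exact_mod_cast ht
  have hint : ∀ s, Integrable ((D s).indicator (1 : Ω → ℝ)) μ := fun s =>
    (integrable_const (1 : ℝ)).indicator (hD s)
  have hm := mul_meas_ge_le_integral_of_nonneg (μ := μ)
    (f := fun x => ∑ s ∈ Finset.range t, (D s).indicator (1 : Ω → ℝ) x)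
    (Eventually.of_forall fun x => Finset.sum_nonneg fun s _ =>
      Set.indicator_nonneg (fun _ _ => zero_le_one) _)
    (integrable_finsetSum _ fun s _ => hint s) (κ * t)
  rw [integral_finsetSum _ fun s _ => hint s] at hm
  simp only [integral_indicator_one (hD _)] at hm
  rw [← mul_assoc, ← mul_inv, inv_mul_eq_div, le_div_iff₀ (by positivity), mul_comm]
  exact hm

section Schedule

variable {K : ℕ} {W : ℕ∞} {p : Fin K → unitInterval} {q : unitInterval}
  {g : ℕ → Option (UserPair K)} {w : ℕ} {θ : UserPair K → ℝ}

lemma measurableSet_shortage (e : UserPair K) (t : ℕ) : MeasurableSet (shortage g w e t) := by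
  have : shortage g w e t = ⋃ j ∈ {j | j ∈ e.1}, {c | ∑ s ∈ Finset.range t, c (j, s) <
      w + w * ∑ e' : UserPair K with j ∈ e'.1, (scheduledSlots g e' t).card} := by
    ext c
    simp [shortage]
  rw [this]
  exact MeasurableSet.biUnion (Set.to_countable _) fun j _ =>
    measurableSet_lt (by fun_prop) measurable_const

lemma card_scheduledSlots_le (e : UserPair K) (t : ℕ) : (scheduledSlots g e t).card ≤ t :=
  (Finset.card_filter_le _ _).trans (Finset.card_range t).le

lemma tendsto_const_div_sq_mul (C : ℝ) {κ : ℝ} (hκ : 0 < κ) :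
    Tendsto (fun t : ℕ => C * t / (κ * t) ^ 2) atTop (𝓝 0) := by
  have h := (tendsto_const_div_atTop_nhds_zero_nat (C / κ ^ 2))
  refine h.congr' ?_
  filter_upwards [eventually_gt_atTop 0] with t ht
  have ht' : (t : ℝ) ≠ 0 := by positivity
  field_simp

lemma tendsto_generationLaw_shortage
    (hg : ∀ e, Tendsto (fun t : ℕ => ((scheduledSlots g e t).card : ℝ) / t) atTop (𝓝 (θ e)))
    (e : UserPair K) (h : ∀ j ∈ e.1, w * ∑ e' : UserPair K with j ∈ e'.1, θ e' < p j) :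
    Tendsto (fun t => (generationLaw p).real (shortage g w e t)) atTop (𝓝 0) := by
  have hnode : ∀ j ∈ e.1, Tendsto (fun t => (generationLaw p).real
      {c | ∑ s ∈ Finset.range t, c (j, s) <
        w + w * ∑ e' : UserPair K with j ∈ e'.1, (scheduledSlots g e' t).card})
      atTop (𝓝 0) := by
    intro j hj
    set κ := ((p j : ℝ) - w * ∑ e' : UserPair K with j ∈ e'.1, θ e') / 2 with hκdef
    have hκ : 0 < κ := half_pos (sub_pos.2 (h j hj))
    have hlim : Tendsto (fun t : ℕ => (w : ℝ) / t + w * ∑ e' : UserPair K with j ∈ e'.1,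
        ((scheduledSlots g e' t).card : ℝ) / t) atTop
        (𝓝 (0 + w * ∑ e' : UserPair K with j ∈ e'.1, θ e')) :=
      (tendsto_const_div_atTop_nhds_zero_nat (w : ℝ)).add
        ((tendsto_finsetSum _ fun e' _ => hg e').const_mul _)
    have hev := hlim.eventually_lt_const (u := p j - κ) (by linarith)
    refine tendsto_of_tendsto_of_tendsto_of_le_of_le' tendsto_const_nhds
      (tendsto_const_div_sq_mul 1 hκ) (Eventually.of_forall fun _ => measureReal_nonneg) ?_
    filter_upwards [hev, eventually_gt_atTop 0] with t hlt ht
    have ht' : (0 : ℝ) < t := by exact_mod_cast ht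
    have hcheb := measureReal_sum_bernoulli_lt_le (fun x : Fin K × ℕ => p x.1)
      ({j} ×ˢ Finset.range t) (c := κ * t) (by positivity)
    simp only [Finset.sum_product, Finset.sum_singleton, Finset.sum_const, Finset.card_range,
      Finset.card_product, Finset.card_singleton, nsmul_eq_mul] at hcheb
    refine le_trans (measureReal_mono fun c hc => ?_) (hcheb.trans (by simp))
    have hc' : (∑ s ∈ Finset.range t, (c (j, s) : ℝ)) < w + w * ∑ e' : UserPair K with j ∈ e'.1,
        ((scheduledSlots g e' t).card : ℝ) := by exact_mod_cast hc
    have heq : (w : ℝ) / t + w * ∑ e' : UserPair K with j ∈ e'.1,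
        ((scheduledSlots g e' t).card : ℝ) / t = (w + w * ∑ e' : UserPair K with j ∈ e'.1,
        ((scheduledSlots g e' t).card : ℝ)) / t := by
      rw [← Finset.sum_div]
      ring
    rw [heq, div_lt_iff₀ ht'] at hlt
    show ∑ s ∈ Finset.range t, (c (j, s) : ℝ) < _
    linarith
  have hsum := tendsto_finsetSum (Finset.univ.filter fun j => j ∈ e.1) fun j hj =>
    hnode j (by simpa using hj)
  rw [Finset.sum_const_zero] at hsum
  refine tendsto_of_tendsto_of_tendsto_of_le_of_le tendsto_const_nhds hsum
    (fun _ => measureReal_nonneg) fun t => ?_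
  refine le_trans (measureReal_mono (fun c hc => ?_) (measure_ne_top _ _))
    (measureReal_biUnion_finset_le _ _)
  obtain ⟨j, hj, hlt⟩ := hc
  exact Set.mem_biUnion (by simpa using hj) hlt

lemma tendsto_outcomeLaw_lt (e : UserPair K) {κ : ℝ} (hκ : 0 < κ) :
    Tendsto (fun t : ℕ => (outcomeLaw K q).real
      {b | ∑ s ∈ scheduledSlots g e t, ∑ n ∈ Finset.range w, (b (e, s, n) : ℝ) <
        q * w * (scheduledSlots g e t).card - κ * t}) atTop (𝓝 0) := by
  refine tendsto_of_tendsto_of_tendsto_of_le_of_le' tendsto_const_nhds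
    (tendsto_const_div_sq_mul w hκ) (Eventually.of_forall fun _ => measureReal_nonneg) ?_
  filter_upwards [eventually_gt_atTop 0] with t ht
  have ht' : (0 : ℝ) < t := by exact_mod_cast ht
  have hcheb := measureReal_sum_bernoulli_lt_le (fun _ : UserPair K × ℕ × ℕ => q)
    ({e} ×ˢ (scheduledSlots g e t ×ˢ Finset.range w)) (c := κ * t) (by positivity)
  simp only [Finset.sum_product, Finset.sum_singleton, Finset.sum_const, Finset.card_range,
    Finset.card_product, Finset.card_singleton, nsmul_eq_mul, one_mul] at hcheb
  have hcard : ((scheduledSlots g e t).card : ℝ) ≤ t := by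
    exact_mod_cast card_scheduledSlots_le e t
  refine le_trans (measureReal_mono fun b hb => ?_) (hcheb.trans ?_)
  · have hb' : ∑ s ∈ scheduledSlots g e t, ∑ n ∈ Finset.range w, (b (e, s, n) : ℝ) <
        q * w * (scheduledSlots g e t).card - κ * t := hb
    refine lt_of_lt_of_eq hb' ?_
    push_cast
    ring
  · push_cast
    rw [mul_comm (w : ℝ)]
    gcongr

/-- A queue whose overflow probability at time `t` exceeds a bound `b` by less than a null sequence
overflows at most the fraction `b` of the time. -/
lemma overflow_le_of_eventually_le {π : Protocol K W}
    {α : UserPair K → ProbabilityMeasure (ℕ → ℕ)} {e : UserPair K} {V b : ℝ} {c : ℕ → ℝ}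
    (hc : Tendsto c atTop (𝓝 0))
    (h : ∀ᶠ t in atTop,
      (switchLaw p q π α).real {ω | V < (pendingRequests π e t ω : ℝ)} ≤ c t + b) :
    overflow p q π α e V ≤ b := by
  set x : ℕ → ℝ := fun t => (switchLaw p q π α).real {ω | V < (pendingRequests π e t ω : ℝ)} with hx
  have h0 : Tendsto (fun t => max (x t - b) 0) atTop (𝓝 0) := by
    have hc' : Tendsto (fun t => max (c t) 0) atTop (𝓝 0) := by
      simpa using hc.max (tendsto_const_nhds (x := (0 : ℝ)))
    refine tendsto_of_tendsto_of_tendsto_of_le_of_le' tendsto_const_nhds hc'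
      (Eventually.of_forall fun _ => le_max_right _ _) ?_
    filter_upwards [h] with t ht
    exact max_le_max_right _ (by linarith)
  have h1 := h0.cesaro.add_const b
  rw [zero_add] at h1
  refine le_trans (limsup_le_limsup ?_ ?_ h1.isBoundedUnder_le) h1.limsup_eq.le
  · filter_upwards [eventually_gt_atTop 0] with t ht
    have ht' : (0 : ℝ) < t := by exact_mod_cast ht
    have hle : ∑ s ∈ Finset.range t, x s ≤
        ∑ s ∈ Finset.range t, max (x s - b) 0 + t * b := by
      calc ∑ s ∈ Finset.range t, x s ≤ ∑ s ∈ Finset.range t, (max (x s - b) 0 + b) :=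
            Finset.sum_le_sum fun s _ => by linarith [le_max_left (x s - b) 0]
        _ = _ := by simp [Finset.sum_add_distrib]
    calc 1 / (t : ℝ) * ∑ s ∈ Finset.range t, x s
        ≤ 1 / (t : ℝ) * (∑ s ∈ Finset.range t, max (x s - b) 0 + t * b) := by gcongr
      _ = (t : ℝ)⁻¹ * ∑ s ∈ Finset.range t, max (x s - b) 0 + b := by field_simp
  · refine IsBoundedUnder.isCoboundedUnder_le ⟨0, ?_⟩
    rw [eventually_map]
    exact Eventually.of_forall fun t => mul_nonneg (by positivity)
      (Finset.sum_nonneg fun _ _ => measureReal_nonneg)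

lemma overflow_nonneg (π : Protocol K W) (α : UserPair K → ProbabilityMeasure (ℕ → ℕ))
    (e : UserPair K) (V : ℝ) : 0 ≤ overflow p q π α e V := by
  refine le_limsup_of_frequently_le (Eventually.frequently (Eventually.of_forall fun t =>
    mul_nonneg (by positivity) (Finset.sum_nonneg fun _ _ => measureReal_nonneg))) ⟨1, ?_⟩
  rw [eventually_map]
  refine Eventually.of_forall fun t => ?_
  rw [one_div, inv_mul_eq_div]
  refine div_le_one_of_le₀ ?_ (by positivity)
  exact (Finset.sum_le_card_nsmul _ _ 1 fun _ _ => measureReal_le_one).trans (by simp)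

/-- If every pair with requests is scheduled often enough, at a rate that leaves EPR pairs to spare
at both its ends, then the schedule stabilizes the switch. -/
theorem switchStable_scheduledProtocol (hw : (w : ℕ∞) ≤ W)
    (hg : ∀ e, Tendsto (fun t : ℕ => ((scheduledSlots g e t).card : ℝ) / t) atTop (𝓝 (θ e)))
    {l : UserPair K → ℝ}
    (hl : ∀ e, l e = 0 ∨ (l e < q * w * θ e ∧
      ∀ j ∈ e.1, w * ∑ e' : UserPair K with j ∈ e'.1, θ e' < p j))
    {α : UserPair K → ProbabilityMeasure (ℕ → ℕ)} (hα : ∀ e, IsRequestLaw (α e) (l e)) :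
    SwitchStable p q (scheduledProtocol g w hw) α := by
  set π := scheduledProtocol g w hw with hπ
  intro e
  set P := switchLaw p q π α with hP
  have hA := measurePreserving_arrivals p q π α e
  have hmA : ∀ i, Measurable fun a : ℕ → ℕ => (a i : ℝ) := fun i =>
    (measurable_of_countable fun x : ℕ => (x : ℝ)).comp (measurable_pi_apply i)
  suffices hb : ∃ c : ℕ → ℝ, Tendsto c atTop (𝓝 0) ∧ ∀ᶠ t in atTop, ∀ V : ℝ, 0 < V →
      P.real {ω | V < (pendingRequests π e t ω : ℝ)} ≤ c t + l e / V by
    obtain ⟨c, hc, hb⟩ := hb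
    refine tendsto_of_tendsto_of_tendsto_of_le_of_le' tendsto_const_nhds
      (tendsto_const_nhds.div_atTop tendsto_id : Tendsto (fun V : ℝ => l e / V) atTop (𝓝 0))
      (Eventually.of_forall fun V => overflow_nonneg π α e V) ?_
    filter_upwards [eventually_gt_atTop 0] with V hV
    exact overflow_le_of_eventually_le hc (hb.mono fun t ht => ht V hV)
  rcases hl e with h0 | ⟨hrate, hnode⟩
  · -- Without requests, the queue stays empty.
    refine ⟨fun _ => 0, tendsto_const_nhds, Eventually.of_forall fun t V hV => ?_⟩
    rw [h0, zero_div, zero_add]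
    have hz : ∀ᵐ a ∂(α e : Measure (ℕ → ℕ)), ∀ s, a s = 0 := by
      rw [ae_all_iff]
      intro s
      have h1 := (hα e).lintegral_eval s
      have hm : Measurable fun a : ℕ → ℕ => (a s : ℝ≥0∞) :=
        (measurable_of_countable fun x : ℕ => (x : ℝ≥0∞)).comp (measurable_pi_apply s)
      rw [h0, ENNReal.ofReal_zero, lintegral_eq_zero_iff hm] at h1
      filter_upwards [h1] with a ha
      simpa using ha
    refine le_of_eq ?_
    rw [measureReal_eq_zero_iff]
    refine measure_mono_null (fun ω hω => ?_) (ae_iff.1 (hA.quasiMeasurePreserving.ae hz))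
    intro hall
    have h2 := pendingRequests_le_sum π ω t e
    rw [Finset.sum_eq_zero fun s _ => hall s, Nat.le_zero] at h2
    have h3 : V < (pendingRequests π e t ω : ℝ) := hω
    rw [h2] at h3
    exact lt_asymm hV (by simpa using h3)
  · set κ := ((q : ℝ) * w * θ e - l e) / 4 with hκdef
    have hκ : 0 < κ := by linarith
    -- The events that spoil the comparison of requests with successful swaps.
    set B₁ : ℕ → Set (ℕ → ℕ) := fun t =>
      {a | (l e + κ) * t < ∑ i ∈ Finset.range t, (a i : ℝ)} with hB₁
    set B₂ : ℕ → Set (UserPair K × ℕ × ℕ → ℕ) := fun t =>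
      {b | ∑ s ∈ scheduledSlots g e t, ∑ n ∈ Finset.range w, (b (e, s, n) : ℝ) <
        q * w * (scheduledSlots g e t).card - κ * t} with hB₂
    set B₃ : ℕ → Set (Fin K × ℕ → ℕ) := fun t =>
      {c | κ / (w + 1) * t ≤ ∑ s ∈ Finset.range t, (shortage g w e s).indicator 1 c} with hB₃
    have l₁ : Tendsto (fun t => (α e : Measure (ℕ → ℕ)).real (B₁ t)) atTop (𝓝 0) :=
      (hα e).tendsto_measureReal_lt_sum (by linarith)
    have l₂ : Tendsto (fun t => (outcomeLaw K q).real (B₂ t)) atTop (𝓝 0) :=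
      tendsto_outcomeLaw_lt e hκ
    have l₃ : Tendsto (fun t => (generationLaw p).real (B₃ t)) atTop (𝓝 0) :=
      tendsto_measureReal_le_sum_indicator (measurableSet_shortage e)
        (tendsto_generationLaw_shortage hg e hnode) (by positivity)
    have m₁ : ∀ t, MeasurableSet (B₁ t) := fun t =>
      measurableSet_lt measurable_const (Finset.measurable_sum _ fun i _ => hmA i)
    have m₂ : ∀ t, MeasurableSet (B₂ t) := fun t =>
      measurableSet_lt (Finset.measurable_sum _ fun s _ => Finset.measurable_sum _ fun n _ =>
        (measurable_of_countable fun x : ℕ => (x : ℝ)).comp (measurable_pi_apply _))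
        measurable_const
    have m₃ : ∀ t, MeasurableSet (B₃ t) := fun t =>
      measurableSet_le measurable_const (Finset.measurable_sum _ fun s _ =>
        measurable_one.indicator (measurableSet_shortage e s))
    refine ⟨fun t => (α e : Measure (ℕ → ℕ)).real (B₁ t) + (outcomeLaw K q).real (B₂ t) +
      (generationLaw p).real (B₃ t), by simpa using (l₁.add l₂).add l₃, ?_⟩
    have hlim : Tendsto (fun t : ℕ => (q : ℝ) * w * (((scheduledSlots g e t).card : ℝ) / t)) atTop
      (𝓝 (q * w * θ e)) := (hg e).const_mul _
    filter_upwards [hlim.eventually_const_lt (u := l e + 3 * κ) (by linarith),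
      eventually_gt_atTop 0] with T hT hT0 V hV
    obtain ⟨t, rfl⟩ : ∃ t, T = t + 1 := ⟨T - 1, by omega⟩
    have hT' : (0 : ℝ) < ((t + 1 : ℕ) : ℝ) := by exact_mod_cast hT0
    replace hT : (l e + 3 * κ) * (t + 1 : ℕ) < q * w * (scheduledSlots g e (t + 1)).card := by
      rw [← lt_div_iff₀ hT', mul_div_assoc]
      exact hT
    have hsub : {ω : Sample K π.Seed | V < (pendingRequests π e (t + 1) ω : ℝ)} ≤ᵐ[P]
        ((((fun ω : Sample K π.Seed => ω.1 e) ⁻¹' B₁ (t + 1) ∪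
          (fun ω : Sample K π.Seed => ω.2.2.1) ⁻¹' B₂ (t + 1)) ∪
          (fun ω : Sample K π.Seed => ω.2.1) ⁻¹' B₃ (t + 1)) ∪
          (fun ω : Sample K π.Seed => ω.1 e) ⁻¹' {a | V ≤ a t} : Set (Sample K π.Seed)) := by
      filter_upwards [ae_outcomes_le_one p q π α] with ω hω
      intro (hV : V < (pendingRequests π e (t + 1) ω : ℝ))
      show ((_ ∨ _) ∨ _) ∨ _
      by_contra! hcon
      obtain ⟨⟨⟨h1, h2⟩, h3⟩, h4⟩ := hcon
      have h1 : ¬ ((l e + κ) * (t + 1 : ℕ) < ∑ i ∈ Finset.range (t + 1), (ω.1 e i : ℝ)) := h1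
      have h2 : ¬ (∑ s ∈ scheduledSlots g e (t + 1), ∑ n ∈ Finset.range w,
        (ω.2.2.1 (e, s, n) : ℝ) <
          q * w * (scheduledSlots g e (t + 1)).card - κ * (t + 1 : ℕ)) := h2
      have h3 : ¬ (κ / (w + 1) * (t + 1 : ℕ) ≤
        ∑ s ∈ Finset.range (t + 1), (shortage g w e s).indicator 1 ω.2.1) := h3
      have h4 : ¬ (V ≤ ω.1 e t) := h4
      have h5 := sum_scheduled_outcomes_le g w hw ω hω (t + 1) e
      push Not at h1 h2 h3
      have h6 : w * ∑ s ∈ Finset.range (t + 1),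
          (shortage g w e s).indicator (1 : (Fin K × ℕ → ℕ) → ℝ) ω.2.1 ≤ κ * (t + 1 : ℕ) := by
        refine (mul_le_mul_of_nonneg_left h3.le (Nat.cast_nonneg w)).trans ?_
        have : (w : ℝ) / (w + 1) ≤ 1 := div_le_one_of_le₀ (by linarith) (by positivity)
        calc (w : ℝ) * (κ / (w + 1) * (t + 1 : ℕ)) = w / (w + 1) * (κ * (t + 1 : ℕ)) := by ring
          _ ≤ 1 * (κ * (t + 1 : ℕ)) := by gcongr
          _ = _ := one_mul _
      have h7 : ∑ i ∈ Finset.range (t + 1), (ω.1 e i : ℝ) ≤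
          ∑ s ∈ Finset.range (t + 1), (successesAt π ω s e : ℝ) := by
        linarith
      have h8 := pendingRequests_succ_le π ω t e (by exact_mod_cast h7)
      exact h4 (hV.le.trans (by exact_mod_cast h8))
    have hmarkov : (α e : Measure (ℕ → ℕ)).real {a | V ≤ a t} ≤ l e / V := by
      have hm : Measurable fun a : ℕ → ℕ => (a t : ℝ≥0∞) :=
        (measurable_of_countable fun x : ℕ => (x : ℝ≥0∞)).comp (measurable_pi_apply t)
      have h1 := mul_meas_ge_le_lintegral (μ := (α e : Measure (ℕ → ℕ))) hm (ENNReal.ofReal V)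
      have hl0 : 0 ≤ l e := (hα e).rate ▸ integral_nonneg fun a => by positivity
      rw [(hα e).lintegral_eval t] at h1
      have h2 := ENNReal.toReal_mono ENNReal.ofReal_ne_top h1
      rw [ENNReal.toReal_mul, ENNReal.toReal_ofReal hV.le, ENNReal.toReal_ofReal hl0] at h2
      rw [le_div_iff₀ hV, mul_comm]
      refine le_trans (le_of_eq ?_) h2
      congr 2
      ext a
      simp [ENNReal.ofReal_le_natCast]
    have hmV : MeasurableSet {a : ℕ → ℕ | V ≤ a t} := measurableSet_le measurable_const (hmA t)
    refine (ENNReal.toReal_mono (measure_ne_top _ _) (measure_mono_ae hsub)).trans ?_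
    refine (measureReal_union_le _ _).trans (add_le_add ((measureReal_union_le _ _).trans
      (add_le_add ((measureReal_union_le _ _).trans (add_le_add ?_ ?_)) ?_)) ?_)
    · exact (hA.measureReal_preimage (m₁ _).nullMeasurableSet).le
    · exact ((measurePreserving_outcomes p q π α).measureReal_preimage
        (m₂ _).nullMeasurableSet).le
    · exact ((measurePreserving_generation p q π α).measureReal_preimage
        (m₃ _).nullMeasurableSet).le
    · exact (hA.measureReal_preimage hmV.nullMeasurableSet).le.trans hmarkov

end Schedule

/-! ### From flows to protocols -/

section Achievability

variable {K : ℕ} {W : ℕ∞} {p : Fin K → unitInterval} {q : unitInterval}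

lemma HasRates.isRequestLaw {α : UserPair K → ProbabilityMeasure (ℕ → ℕ)} {l : UserPair K → ℝ}
    (h : HasRates α (rateMatrix l)) (e : UserPair K) : IsRequestLaw (α e) (l e) := by
  obtain ⟨i, j, hij, rfl⟩ := exists_eq_userPair e
  simpa only [rateMatrix_of_ne _ hij] using h i j hij

/-- Rates that a flow serves with strict inequality, wherever they do not vanish, can be
stabilized: the flow is scaled down slightly, so as to spare EPR pairs, and turned into a schedule
that serves a single pair per slot. -/
theorem exists_protocol_of_isFlow {l φ : UserPair K → ℝ} (hl : ∀ e, 0 ≤ l e)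
    (hφ : IsFlow p W φ) (hlφ : ∀ e, l e = 0 ∨ l e < q * φ e) :
    ∃ π : Protocol K W, ∀ α, HasRates α (rateMatrix l) → SwitchStable p q π α := by
  obtain ⟨w, hwW, hw⟩ : ∃ w : ℕ, (w : ℕ∞) ≤ W ∧ ∑ e, φ e ≤ w := by
    induction W with
    | top => exact ⟨⌈∑ e, φ e⌉₊, le_top, Nat.le_ceil _⟩
    | coe n =>
      refine ⟨n, le_rfl, ?_⟩
      have := hφ.total_le
      rwa [ENat.toENNReal_coe, ENNReal.ofReal_le_natCast] at this
  obtain ⟨c, hc, hc0, hc1⟩ : ∃ c : ℝ, (∀ e, l e = 0 ∨ l e < q * (c * φ e)) ∧ 0 < c ∧ c < 1 := by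
    have h1 : ∀ᶠ c in 𝓝[<] (1 : ℝ), ∀ e, l e = 0 ∨ l e < q * (c * φ e) := by
      rw [eventually_all]
      intro e
      rcases hlφ e with h | h
      · exact Eventually.of_forall fun _ => Or.inl h
      · have hlim : Tendsto (fun c : ℝ => q * (c * φ e)) (𝓝[<] 1) (𝓝 (q * (1 * φ e))) :=
          ((continuous_id.mul continuous_const).const_mul (q : ℝ)).continuousWithinAt
        exact (hlim.eventually_const_lt (by simpa using h)).mono fun _ => Or.inr
    obtain ⟨c, h, hc0, hc1⟩ := (h1.and (Ioo_mem_nhdsLT (zero_lt_one' ℝ))).exists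
    exact ⟨c, h, hc0, hc1⟩
  have hwθ : ∀ e, (w : ℝ) * (c * φ e / w) = c * φ e := by
    intro e
    rcases Nat.eq_zero_or_pos w with h0 | hpos
    · have h2 : φ e ≤ 0 := by
        refine (Finset.single_le_sum (f := φ) (fun e _ => hφ.nonneg e) (Finset.mem_univ e)).trans ?_
        simpa [h0] using hw
      simp [le_antisymm h2 (hφ.nonneg e)]
    · field_simp
  obtain ⟨g, hg⟩ := exists_seq_tendsto_frequency (fun e => c * φ e / w)
    (fun e => by have := hφ.nonneg e; positivity) (by
      rw [← Finset.sum_div, ← Finset.mul_sum]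
      refine div_le_one_of_le₀ ?_ (by positivity)
      have : 0 ≤ ∑ e, φ e := Finset.sum_nonneg fun e _ => hφ.nonneg e
      nlinarith)
  refine ⟨scheduledProtocol g w hwW, fun α hα =>
    switchStable_scheduledProtocol hwW hg (fun e => ?_) hα.isRequestLaw⟩
  refine (hc e).imp_right fun h => ⟨by rwa [mul_assoc, hwθ], fun j hj => ?_⟩
  have hφe : 0 < φ e := by
    by_contra! hneg
    have h0 : φ e = 0 := le_antisymm hneg (hφ.nonneg e)
    rw [h0, mul_zero, mul_zero] at h
    exact absurd h (hl e).not_gt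
  have hpj : (0 : ℝ) < p j := hφe.trans_le (hφ.le_node hj)
  rw [Finset.mul_sum, Finset.sum_congr rfl fun e' _ => hwθ e', ← Finset.mul_sum]
  calc c * ∑ e' : UserPair K with j ∈ e'.1, φ e' ≤ c * p j := by
        gcongr
        exact hφ.node_le j
    _ < p j := by nlinarith

end Achievability

/-! ### Measurability and causality of the dynamics -/

section Measurability

variable {K : ℕ} {W : ℕ∞}

instance : Countable (SlotRecord K) :=
  Function.Injective.countable (f := fun r : SlotRecord K => (r.A, r.C, r.F, r.R)) <| by
    rintro ⟨⟩ ⟨⟩ h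
    simpa using h

/-- There are countably many histories, and every set of them is measurable. -/
instance : MeasurableSpace (History K) := ⊤

instance : DiscreteMeasurableSpace (History K) := ⟨fun _ => trivial⟩

instance : Countable (History K) := inferInstanceAs (Countable (List (SlotRecord K)))

variable (π : Protocol K W)

lemma measurable_attempts_uncurry (e : UserPair K) :
    Measurable fun x : History K × π.Seed => π.attempts x.1 x.2 e :=
  measurable_from_prod_countable_right fun h =>
    (measurable_pi_apply e).comp (π.measurable_attempts h)

lemma measurable_successes_of_attempts {t : ℕ} {e : UserPair K}
    (h : Measurable fun ω : Sample K π.Seed => attemptsAt π ω t e) :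
    Measurable fun ω : Sample K π.Seed => successesAt π ω t e := by
  have h1 : Measurable fun x : ℕ × Sample K π.Seed =>
      ∑ n ∈ Finset.range x.1, x.2.2.2.1 (e, t, n) :=
    measurable_from_prod_countable_right fun k =>
      Finset.measurable_sum (f := fun n (ω : Sample K π.Seed) => ω.2.2.1 (e, t, n))
        (Finset.range k) fun n _ => by fun_prop
  exact h1.comp (h.prodMk measurable_id)

lemma measurable_runHistory (t : ℕ) : Measurable fun ω : Sample K π.Seed => runHistory π ω t := by
  induction t with
  | zero => exact measurable_const
  | succ t ih =>
    have hF : ∀ e, Measurable fun ω : Sample K π.Seed => attemptsAt π ω t e := fun e =>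
      (measurable_attempts_uncurry π e).comp (ih.prodMk (by fun_prop))
    have hR := fun e => measurable_successes_of_attempts π (hF e)
    let G : ((UserPair K → ℕ) × (Fin K → ℕ) × (UserPair K → ℕ) × (UserPair K → ℕ)) × History K →
      History K := fun x => ⟨x.1.1, x.1.2.1, x.1.2.2.1, x.1.2.2.2⟩ :: x.2
    have hG : Measurable G := measurable_of_countable G
    refine hG.comp (f := fun ω : Sample K π.Seed => ((fun e => ω.1 e t, fun j => ω.2.1 (j, t),
      fun e => attemptsAt π ω t e, fun e => successesAt π ω t e), runHistory π ω t)) ?_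
    refine Measurable.prodMk (Measurable.prodMk ?_ (Measurable.prodMk ?_
      (Measurable.prodMk ?_ ?_))) ih
    · fun_prop
    · fun_prop
    · exact measurable_pi_iff.2 hF
    · exact measurable_pi_iff.2 hR

lemma measurable_attemptsAt (t : ℕ) (e : UserPair K) :
    Measurable fun ω : Sample K π.Seed => attemptsAt π ω t e :=
  (measurable_attempts_uncurry π e).comp ((measurable_runHistory π t).prodMk (by fun_prop))

lemma measurable_successesAt (t : ℕ) (e : UserPair K) :
    Measurable fun ω : Sample K π.Seed => successesAt π ω t e :=
  measurable_successes_of_attempts π (measurable_attemptsAt π t e)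

lemma measurable_pendingRequests (e : UserPair K) (t : ℕ) :
    Measurable fun ω : Sample K π.Seed => pendingRequests π e t ω :=
  (measurable_of_countable fun h : History K => (History.state h).U e).comp
    (measurable_runHistory π t)

/-- The history before slot `t` does not depend on the outcomes of the swaps of later slots. -/
lemma runHistory_congr_outcomes {a : UserPair K → ℕ → ℕ} {c : Fin K × ℕ → ℕ}
    {b b' : UserPair K × ℕ × ℕ → ℕ} {s : π.Seed} {t : ℕ}
    (h : ∀ e, ∀ u < t, ∀ n, b (e, u, n) = b' (e, u, n)) :
    runHistory π (a, c, b, s) t = runHistory π (a, c, b', s) t := by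
  induction t with
  | zero => rfl
  | succ t ih =>
    have h1 := ih fun e u hu n => h e u (by omega) n
    simp only [runHistory, h1]
    congr 2
    funext e
    exact Finset.sum_congr rfl fun n _ => h e t (by omega) n

end Measurability

/-! ### Mean numbers of attempted swaps -/

section Converse

variable {K : ℕ} {W : ℕ∞} (p : Fin K → unitInterval) (q : unitInterval) (π : Protocol K W)
  (α : UserPair K → ProbabilityMeasure (ℕ → ℕ))

lemma measurable_natCast_ennreal {Ω : Type*} [MeasurableSpace Ω] {f : Ω → ℕ} (hf : Measurable f) :
    Measurable fun x => (f x : ℝ≥0∞) :=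
  (measurable_of_countable fun n : ℕ => (n : ℝ≥0∞)).comp hf

lemma lintegral_mul_outcome (x : UserPair K × ℕ × ℕ) {f : Sample K π.Seed → ℝ≥0∞}
    (hf : Measurable f)
    (hx : ∀ a c b s y, f (a, c, Function.update b x y, s) = f (a, c, b, s)) :
    ∫⁻ ω, f ω * (ω.2.2.1 x : ℝ≥0∞) ∂switchLaw p q π α =
      ENNReal.ofReal q * ∫⁻ ω, f ω ∂switchLaw p q π α := by
  have hm : Measurable fun ω : Sample K π.Seed => (ω.2.2.1 x : ℝ≥0∞) :=
    measurable_natCast_ennreal (by fun_prop)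
  have hfm : Measurable fun ω => f ω * (ω.2.2.1 x : ℝ≥0∞) := hf.mul hm
  have key : ∀ a c, ∫⁻ b, ∫⁻ s, f (a, c, b, s) * (b x : ℝ≥0∞) ∂(π.seedLaw : Measure π.Seed)
      ∂outcomeLaw K q = ENNReal.ofReal q *
        ∫⁻ b, ∫⁻ s, f (a, c, b, s) ∂(π.seedLaw : Measure π.Seed) ∂outcomeLaw K q := by
    intro a c
    have h1 : ∀ b, ∫⁻ s, f (a, c, b, s) * (b x : ℝ≥0∞) ∂(π.seedLaw : Measure π.Seed) =
        (∫⁻ s, f (a, c, b, s) ∂(π.seedLaw : Measure π.Seed)) * (b x : ℝ≥0∞) := fun b =>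
      lintegral_mul_const _ (hf.comp (by fun_prop))
    have h2 : Measurable fun b => ∫⁻ s, f (a, c, b, s) ∂(π.seedLaw : Measure π.Seed) :=
      Measurable.lintegral_prod_right'
        (f := fun y : (UserPair K × ℕ × ℕ → ℕ) × π.Seed => f (a, c, y.1, y.2))
        (hf.comp (by fun_prop))
    simp_rw [h1]
    rw [mul_comm, ← lintegral_bernoulliMeasure_one_zero q]
    exact lintegral_mul_comp_eval_infinitePi (fun _ : UserPair K × ℕ × ℕ =>
      bernoulliMeasure (1 : ℕ) 0 q) x h2 (fun b y => by simp only [hx])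
      (measurable_of_countable fun n : ℕ => (n : ℝ≥0∞))
  have hq : ENNReal.ofReal q ≠ ∞ := ENNReal.ofReal_ne_top
  have expand : ∀ F : Sample K π.Seed → ℝ≥0∞, Measurable F → ∫⁻ ω, F ω ∂switchLaw p q π α =
      ∫⁻ a, ∫⁻ c, ∫⁻ b, ∫⁻ s, F (a, c, b, s) ∂(π.seedLaw : Measure π.Seed) ∂outcomeLaw K q
        ∂generationLaw p ∂(Measure.pi fun e => (α e : Measure (ℕ → ℕ))) := by
    intro F hF
    rw [switchLaw_eq, lintegral_prod _ hF.aemeasurable]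
    refine lintegral_congr fun a => ?_
    have h1 : Measurable fun y => F (a, y) := hF.comp measurable_prodMk_left
    rw [lintegral_prod _ h1.aemeasurable]
    refine lintegral_congr fun c => ?_
    exact lintegral_prod _ (h1.comp measurable_prodMk_left).aemeasurable
  rw [expand _ hfm, expand _ hf]
  simp only [key, lintegral_const_mul' _ _ hq]

/-- The swaps of a slot are decided before their outcomes are drawn, so the mean number of
successes is `q` times the mean number of attempts. -/
lemma lintegral_successesAt (t : ℕ) (e : UserPair K) :
    ∫⁻ ω, (successesAt π ω t e : ℝ≥0∞) ∂switchLaw p q π α =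
      ENNReal.ofReal q * ∫⁻ ω, (attemptsAt π ω t e : ℝ≥0∞) ∂switchLaw p q π α := by
  classical
  let f : ℕ → Sample K π.Seed → ℝ≥0∞ := fun n ω => if n < attemptsAt π ω t e then 1 else 0
  have hf : ∀ n, Measurable (f n) := fun n =>
    Measurable.ite (measurableSet_lt measurable_const (measurable_attemptsAt π t e))
      measurable_const measurable_const
  have hR : ∀ ω, (successesAt π ω t e : ℝ≥0∞) = ∑' n, f n ω * (ω.2.2.1 (e, t, n) : ℝ≥0∞) := by
    intro ω
    rw [tsum_eq_sum (s := Finset.range (attemptsAt π ω t e)), successesAt, Nat.cast_sum]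
    · refine Finset.sum_congr rfl fun n hn => ?_
      simp [f, Finset.mem_range.1 hn]
    · intro n hn
      have : ¬ n < attemptsAt π ω t e := by simpa using hn
      simp [f, this]
  have hF : ∀ ω, (attemptsAt π ω t e : ℝ≥0∞) = ∑' n, f n ω := by
    intro ω
    rw [tsum_eq_sum (s := Finset.range (attemptsAt π ω t e))]
    · rw [Finset.sum_congr rfl fun n hn => if_pos (Finset.mem_range.1 hn)]
      simp
    · intro n hn
      exact if_neg (by simpa using hn)
  have hm : ∀ n, Measurable fun ω : Sample K π.Seed => f n ω * (ω.2.2.1 (e, t, n) : ℝ≥0∞) :=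
    fun n => (hf n).mul (measurable_natCast_ennreal (by fun_prop))
  simp_rw [hR, hF]
  rw [lintegral_tsum fun n => (hm n).aemeasurable, lintegral_tsum fun n => (hf n).aemeasurable,
    ← ENNReal.tsum_mul_left]
  refine tsum_congr fun n => lintegral_mul_outcome p q π α _ (hf n) fun a c b s y => ?_
  have : attemptsAt π (a, c, Function.update b (e, t, n) y, s) t e =
      attemptsAt π (a, c, b, s) t e := by
    simp only [attemptsAt]
    rw [runHistory_congr_outcomes π (b' := b)]
    intro e' u hu n'
    exact Function.update_of_ne (by simp; omega) _ _
  simp only [f, this]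

/-- The mean number of swaps attempted for a pair before time `t`. -/
noncomputable def meanAttempts (t : ℕ) (e : UserPair K) : ℝ≥0∞ :=
  ∑ s ∈ Finset.range t, ∫⁻ ω, (attemptsAt π ω s e : ℝ≥0∞) ∂switchLaw p q π α

lemma sum_meanAttempts (t : ℕ) (S : Finset (UserPair K)) :
    ∑ e ∈ S, meanAttempts p q π α t e =
      ∫⁻ ω, ((∑ s ∈ Finset.range t, ∑ e ∈ S, attemptsAt π ω s e : ℕ) : ℝ≥0∞)
        ∂switchLaw p q π α := by
  have hm : ∀ s e, Measurable fun ω : Sample K π.Seed => (attemptsAt π ω s e : ℝ≥0∞) :=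
    fun s e => measurable_natCast_ennreal (measurable_attemptsAt π s e)
  simp only [meanAttempts, Nat.cast_sum]
  rw [Finset.sum_comm, lintegral_finsetSum _ fun s _ => Finset.measurable_sum _ fun e _ => hm s e]
  exact Finset.sum_congr rfl fun s _ => (lintegral_finsetSum _ fun e _ => hm s e).symm

lemma sum_meanAttempts_node_le (t : ℕ) (j : Fin K) :
    ∑ e : UserPair K with j ∈ e.1, meanAttempts p q π α t e ≤ t * ENNReal.ofReal (p j) := by
  have hm : ∀ s, Measurable fun ω : Sample K π.Seed => (ω.2.1 (j, s) : ℝ≥0∞) :=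
    fun s => measurable_natCast_ennreal (by fun_prop)
  rw [sum_meanAttempts]
  calc _ ≤ ∫⁻ ω, ∑ s ∈ Finset.range t, (ω.2.1 (j, s) : ℝ≥0∞) ∂switchLaw p q π α := by
        refine lintegral_mono fun ω => ?_
        rw [← Nat.cast_sum, ← stored_add_attempts π ω t j]
        exact Nat.cast_le.2 (Nat.le_add_left _ _)
    _ = ∑ s ∈ Finset.range t, ENNReal.ofReal (p j) := by
        rw [lintegral_finsetSum _ fun s _ => hm s]
        refine Finset.sum_congr rfl fun s _ => ?_
        have h1 := (measurePreserving_generation p q π α).lintegral_comp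
          (f := fun c => (c (j, s) : ℝ≥0∞)) (measurable_natCast_ennreal (by fun_prop))
        have h2 := (measurePreserving_eval_generation p (j, s)).lintegral_comp
          (f := fun n : ℕ => (n : ℝ≥0∞)) (measurable_of_countable _)
        rw [h1, h2, lintegral_bernoulliMeasure_one_zero]
    _ = _ := by simp

lemma sum_meanAttempts_le (t : ℕ) : ∑ e, meanAttempts p q π α t e ≤ t * (W : ℝ≥0∞) := by
  rw [sum_meanAttempts]
  calc _ ≤ ∫⁻ _, t * (W : ℝ≥0∞) ∂switchLaw p q π α := by
        refine lintegral_mono fun ω => ?_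
        rw [Nat.cast_sum]
        refine (Finset.sum_le_card_nsmul _ _ (W : ℝ≥0∞) fun s _ => ?_).trans (by simp)
        have := ENat.toENNReal_le.2 (π.attempts_le_limit (runHistory π ω s) ω.2.2.2)
        rwa [ENat.toENNReal_coe] at this
    _ = _ := by simp

lemma meanAttempts_ne_top (t : ℕ) (e : UserPair K) : meanAttempts p q π α t e ≠ ∞ := by
  obtain ⟨i, j, hij, rfl⟩ := exists_eq_userPair e
  refine ne_top_of_le_ne_top (ENNReal.mul_ne_top (ENNReal.natCast_ne_top t)
    (ENNReal.ofReal_ne_top (r := p i))) (le_trans ?_ (sum_meanAttempts_node_le p q π α t i))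
  exact Finset.single_le_sum (f := meanAttempts p q π α t) (fun _ _ => bot_le)
    (by simp [userPair])

lemma isFlow_meanAttempts {t : ℕ} (ht : 0 < t) :
    IsFlow p W fun e => (meanAttempts p q π α t e).toReal / t := by
  have ht' : (0 : ℝ) < t := by exact_mod_cast ht
  have hsum : ∀ S : Finset (UserPair K), ∑ e ∈ S, (meanAttempts p q π α t e).toReal / t =
      (∑ e ∈ S, meanAttempts p q π α t e).toReal / t := fun S => by
    rw [ENNReal.toReal_sum fun e _ => meanAttempts_ne_top p q π α t e, Finset.sum_div]
  refine ⟨fun e => by positivity, fun j => ?_, ?_⟩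
  · rw [hsum, div_le_iff₀ ht']
    have h := ENNReal.toReal_mono (ENNReal.mul_ne_top (ENNReal.natCast_ne_top t)
      ENNReal.ofReal_ne_top) (sum_meanAttempts_node_le p q π α t j)
    rw [ENNReal.toReal_mul, ENNReal.toReal_natCast, ENNReal.toReal_ofReal (p j).2.1] at h
    linarith
  · rw [hsum, ENNReal.ofReal_div_of_pos ht', ENNReal.ofReal_natCast]
    refine ENNReal.div_le_of_le_mul ?_
    rw [mul_comm]
    exact ENNReal.ofReal_toReal_le.trans (sum_meanAttempts_le p q π α t)

end Converse

/-! ### Necessity -/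

section Necessity

variable {K : ℕ} {W : ℕ∞} {p : Fin K → unitInterval} {q : unitInterval} {π : Protocol K W}
  {α : UserPair K → ProbabilityMeasure (ℕ → ℕ)}

/-- Stability provides arbitrarily late times at which all queues are short with high
probability. -/
lemma SwitchStable.exists_time (h : SwitchStable p q π α) {δ : ℝ} (hδ : 0 < δ) :
    ∃ V : ℝ, 0 < V ∧ ∀ T₀ : ℕ, ∃ t ≥ T₀, ∀ e,
      (switchLaw p q π α).real {ω | V < (pendingRequests π e t ω : ℝ)} < δ := by
  set N := ((Fintype.card (UserPair K) : ℕ) : ℝ) with hN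
  have hN0 : 0 ≤ N := Nat.cast_nonneg _
  set δ' := δ / (2 * (N + 1)) with hδ'
  have hδ'0 : 0 < δ' := by positivity
  have hV : ∀ᶠ V in atTop, ∀ e, overflow p q π α e V < δ' :=
    eventually_all.2 fun e => (h e).eventually_lt_const hδ'0
  obtain ⟨V, hV, hV0⟩ := (hV.and (eventually_gt_atTop 0)).exists
  refine ⟨V, hV0, fun T₀ => ?_⟩
  set x : UserPair K → ℕ → ℝ := fun e t =>
    (switchLaw p q π α).real {ω | V < (pendingRequests π e t ω : ℝ)} with hx
  have hx0 : ∀ e t, 0 ≤ x e t := fun _ _ => measureReal_nonneg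
  have hev : ∀ᶠ t : ℕ in atTop, ∀ e, 1 / (t : ℝ) * ∑ s ∈ Finset.range t, x e s < δ' := by
    rw [eventually_all]
    intro e
    refine eventually_lt_of_limsup_lt (hV e) ⟨1, ?_⟩
    rw [eventually_map]
    refine Eventually.of_forall fun t => ?_
    rw [one_div, inv_mul_eq_div]
    refine div_le_one_of_le₀ ?_ (by positivity)
    exact (Finset.sum_le_card_nsmul _ _ 1 fun _ _ => measureReal_le_one).trans (by simp)
  obtain ⟨t, ht, ht1⟩ := (hev.and (eventually_ge_atTop (2 * T₀ + 1))).exists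
  have ht' : (0 : ℝ) < t := by exact_mod_cast (by omega : 0 < t)
  by_contra! hcon
  -- If some queue is long at every time after `T₀`, then the averages up to `t ≥ 2 T₀` are large.
  have hlow : ∑ s ∈ Finset.Ico T₀ t, δ ≤ ∑ s ∈ Finset.range t, ∑ e, x e s := by
    calc ∑ s ∈ Finset.Ico T₀ t, δ ≤ ∑ s ∈ Finset.Ico T₀ t, ∑ e, x e s := by
          refine Finset.sum_le_sum fun s hs => ?_
          obtain ⟨e, he⟩ := hcon s (Finset.mem_Ico.1 hs).1
          exact he.trans (Finset.single_le_sum (f := fun e => x e s) (fun e _ => hx0 e s)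
            (Finset.mem_univ e))
      _ ≤ _ := by
          refine Finset.sum_le_sum_of_subset_of_nonneg ?_ fun s _ _ =>
            Finset.sum_nonneg fun e _ => hx0 e s
          intro s hs
          exact Finset.mem_range.2 (Finset.mem_Ico.1 hs).2
  have hhigh : ∑ s ∈ Finset.range t, ∑ e, x e s ≤ N * (δ' * t) := by
    rw [Finset.sum_comm]
    refine (Finset.sum_le_card_nsmul _ _ (δ' * t) fun e _ => ?_).trans (by simp [hN])
    have := (ht e).le
    rwa [one_div, inv_mul_le_iff₀ ht', mul_comm] at this
  rw [Finset.sum_const, Nat.card_Ico, nsmul_eq_mul, Nat.cast_sub (by omega)] at hlow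
  have h1 : N * (δ' * t) < δ * t / 2 := by
    have h2 : (N + 1) * δ' = δ / 2 := by rw [hδ']; field_simp
    nlinarith [mul_pos hδ'0 ht']
  have h3 : (2 * T₀ + 1 : ℝ) ≤ t := by exact_mod_cast ht1
  nlinarith

/-- Requests served before time `t` use up successful swaps. The requests that arrive while the
queue ends up longer than `V` are controlled by their second moment, through
`a 1_B ≤ ε a² + ε⁻¹ 1_B`. -/
lemma rate_mul_le {l : ℝ} {e : UserPair K} (hα : IsRequestLaw (α e) l) {M : ℝ}
    (hM0 : 0 ≤ M)
    (hM : ∀ t, ∫⁻ a, (a t : ℝ≥0∞) ^ 2 ∂(α e : Measure (ℕ → ℕ)) ≤ ENNReal.ofReal M)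
    {V ε : ℝ} (hV : 0 ≤ V) (hε : 0 < ε) (t : ℕ) :
    t * l ≤ q * (meanAttempts p q π α t e).toReal + V + t * (ε * M + ε⁻¹ *
      (switchLaw p q π α).real {ω | V < (pendingRequests π e t ω : ℝ)}) := by
  set P := switchLaw p q π α with hP
  set B : Set (Sample K π.Seed) := {ω | V < (pendingRequests π e t ω : ℝ)} with hB
  have hBm : MeasurableSet B := measurableSet_lt measurable_const
    ((measurable_of_countable fun n : ℕ => (n : ℝ)).comp (measurable_pendingRequests π e t))
  have hl0 : 0 ≤ l := hα.rate ▸ integral_nonneg fun a => by positivity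
  have hmp := measurePreserving_arrivals p q π α e
  have hAm : ∀ s, Measurable fun ω : Sample K π.Seed => (ω.1 e s : ℝ≥0∞) := fun s =>
    measurable_natCast_ennreal (by fun_prop)
  have hRm : ∀ s, Measurable fun ω : Sample K π.Seed => (successesAt π ω s e : ℝ≥0∞) :=
    fun s => measurable_natCast_ennreal (measurable_successesAt π s e)
  have hTm : ∀ s, Measurable fun ω : Sample K π.Seed =>
      ENNReal.ofReal ε * (ω.1 e s : ℝ≥0∞) ^ 2 + ENNReal.ofReal ε⁻¹ * B.indicator 1 ω := fun s =>
    (((hAm s).pow_const 2).const_mul _).add ((measurable_one.indicator hBm).const_mul _)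
  have hpt : ∀ ω : Sample K π.Seed, ∑ s ∈ Finset.range t, (ω.1 e s : ℝ≥0∞) ≤
      (∑ s ∈ Finset.range t, (successesAt π ω s e : ℝ≥0∞) + ENNReal.ofReal V) +
        ∑ s ∈ Finset.range t, (ENNReal.ofReal ε * (ω.1 e s : ℝ≥0∞) ^ 2 +
          ENNReal.ofReal ε⁻¹ * B.indicator 1 ω) := by
    intro ω
    by_cases hω : ω ∈ B
    · refine le_trans (Finset.sum_le_sum fun s _ => ?_) le_add_self
      rw [Set.indicator_of_mem hω, Pi.one_apply, mul_one, ← ENNReal.ofReal_natCast,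
        ← ENNReal.ofReal_pow (by positivity), ← ENNReal.ofReal_mul hε.le,
        ← ENNReal.ofReal_add (by positivity) (by positivity)]
      refine ENNReal.ofReal_le_ofReal ?_
      have h1 : 0 ≤ (ω.1 e s : ℝ) := by positivity
      have h2 : ε * ε⁻¹ = 1 := mul_inv_cancel₀ hε.ne'
      have h3 : 0 < ε⁻¹ := inv_pos.2 hε
      have h4 : 0 ≤ ε⁻¹ * (ε * (ω.1 e s : ℝ) - 1) ^ 2 := by positivity
      have h5 : ε⁻¹ * (ε * (ω.1 e s : ℝ) - 1) ^ 2 =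
          ε * (ω.1 e s : ℝ) ^ 2 - 2 * (ω.1 e s : ℝ) + ε⁻¹ := by
        field_simp
        ring
      linarith
    · refine le_trans ?_ le_self_add
      have h1 := sum_arrivals_le π ω t e
      have h2 : (pendingRequests π e t ω : ℝ) ≤ V := not_lt.1 hω
      calc ∑ s ∈ Finset.range t, (ω.1 e s : ℝ≥0∞)
          ≤ (pendingRequests π e t ω : ℝ≥0∞) +
            ∑ s ∈ Finset.range t, (successesAt π ω s e : ℝ≥0∞) := by exact_mod_cast h1
        _ ≤ _ := by
          rw [add_comm, ← ENNReal.ofReal_natCast]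
          gcongr
  have hint := lintegral_mono (μ := P) hpt
  rw [lintegral_add_right _ (Finset.measurable_sum _ fun s _ => hTm s),
    lintegral_add_right _ measurable_const, lintegral_finsetSum _ fun s _ => hAm s,
    lintegral_finsetSum _ fun s _ => hRm s, lintegral_finsetSum _ fun s _ => hTm s] at hint
  have e1 : ∀ s, ∫⁻ ω, (ω.1 e s : ℝ≥0∞) ∂P = ENNReal.ofReal l := fun s =>
    (hmp.lintegral_comp (f := fun a => (a s : ℝ≥0∞))
      (measurable_natCast_ennreal (by fun_prop))).trans (hα.lintegral_eval s)
  have e2 : ∀ s, ∫⁻ ω, (ENNReal.ofReal ε * (ω.1 e s : ℝ≥0∞) ^ 2 +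
      ENNReal.ofReal ε⁻¹ * B.indicator 1 ω) ∂P ≤ ENNReal.ofReal (ε * M + ε⁻¹ * P.real B) := by
    intro s
    rw [lintegral_add_right _ ((measurable_one.indicator hBm).const_mul _),
      lintegral_const_mul _ ((hAm s).pow_const 2),
      lintegral_const_mul _ (measurable_one.indicator hBm), lintegral_indicator_one hBm,
      ENNReal.ofReal_add (by positivity) (by positivity), ENNReal.ofReal_mul hε.le,
      ENNReal.ofReal_mul (inv_pos.2 hε).le, ofReal_measureReal]
    gcongr
    exact (hmp.lintegral_comp (f := fun a => (a s : ℝ≥0∞) ^ 2)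
      ((measurable_natCast_ennreal (by fun_prop)).pow_const 2)).trans_le (hM s)
  rw [Finset.sum_congr rfl fun s _ => e1 s,
    Finset.sum_congr rfl fun s _ => lintegral_successesAt p q π α s e, ← Finset.mul_sum] at hint
  have hint2 : ENNReal.ofReal (t * l) ≤ ENNReal.ofReal (q * (meanAttempts p q π α t e).toReal + V +
      t * (ε * M + ε⁻¹ * P.real B)) := by
    have hq0 : (0 : ℝ) ≤ q := q.2.1
    rw [ENNReal.ofReal_add (by positivity) (by positivity), ENNReal.ofReal_add (by positivity) hV,
      ENNReal.ofReal_mul hq0, ENNReal.ofReal_toReal (meanAttempts_ne_top p q π α t e),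
      ENNReal.ofReal_mul (by positivity), ENNReal.ofReal_mul (by positivity),
      ENNReal.ofReal_natCast]
    refine le_trans (le_of_eq (by simp)) (hint.trans ?_)
    refine add_le_add (le_of_eq (by simp [meanAttempts, hP])) ?_
    exact (Finset.sum_le_card_nsmul _ _ _ fun s _ => e2 s).trans (by simp)
  exact (ENNReal.ofReal_le_ofReal_iff (by have hq0 : (0 : ℝ) ≤ q := q.2.1; positivity)).1 hint2

/-- The rates of a stable switch are served by a flow, obtained as a limit of the mean numbers of
attempted swaps per slot. -/
theorem SwitchStable.mem_flowRegion (h : SwitchStable p q π α)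
    {lam : Matrix (Fin K) (Fin K) ℝ} (hlam : IsRateMatrix lam) (hα : HasRates α lam) :
    lam ∈ flowRegion p q W := by
  obtain ⟨l, hl, rfl⟩ := hlam.exists_eq_rateMatrix
  refine (rateMatrix_mem_flowRegion hl).2 (exists_isFlow_of_approx fun η hη => ?_)
  choose M hM using fun e => (hα.isRequestLaw e).exists_lintegral_sq_le
  set M₀ := ∑ e, |M e| with hM₀
  have hM₀0 : 0 ≤ M₀ := Finset.sum_nonneg fun e _ => abs_nonneg _
  have hMle : ∀ e, M e ≤ M₀ := fun e => (le_abs_self _).trans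
    (Finset.single_le_sum (f := fun e => |M e|) (fun e _ => abs_nonneg _) (Finset.mem_univ e))
  -- Each of the three error terms in `rate_mul_le` is made at most `η / 3` per slot.
  set ε := η / (3 * (M₀ + 1)) with hε
  have hε0 : 0 < ε := by positivity
  obtain ⟨V, hV, htime⟩ := h.exists_time (δ := ε * (η / 3)) (by positivity)
  obtain ⟨t, ht, hPt⟩ := htime (⌈V / (η / 3)⌉₊ + 1)
  have ht0 : 0 < t := by omega
  have ht' : (0 : ℝ) < t := by exact_mod_cast ht0
  refine ⟨_, isFlow_meanAttempts p q π α ht0, fun e => ?_⟩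
  have hrate := rate_mul_le (p := p) (q := q) (π := π) (hα.isRequestLaw e) hM₀0
    (fun s => (hM e s).trans (ENNReal.ofReal_le_ofReal (hMle e))) hV.le hε0 t
  have h1 : V ≤ t * (η / 3) := by
    rw [← div_le_iff₀ (by positivity)]
    exact (Nat.le_ceil _).trans (by exact_mod_cast (by omega))
  have h2 : ε * M₀ ≤ η / 3 := by
    have : ε * (M₀ + 1) = η / 3 := by rw [hε]; field_simp
    linarith
  have h3 : ε⁻¹ * (switchLaw p q π α).real {ω | V < (pendingRequests π e t ω : ℝ)} ≤ η / 3 := by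
    rw [inv_mul_le_iff₀ hε0]
    exact (hPt e).le
  rw [← mul_div_assoc, le_div_iff₀ ht']
  nlinarith

end Necessity

/-! ### The capacity region -/

theorem theorem1 (K : ℕ) (p : Fin K → unitInterval) (q : unitInterval) (W : ℕ∞) :
    capacityRegion p q W = flowRegion p q W ∧
    (∀ lam : Matrix (Fin K) (Fin K) ℝ, IsRateMatrix lam →
      ∀ α : UserPair K → ProbabilityMeasure (ℕ → ℕ), HasRates α lam →
      ∀ π : Protocol K W, SwitchStable p q π α → lam ∈ flowRegion p q W) ∧
    (∀ lam : Matrix (Fin K) (Fin K) ℝ, IsRateMatrix lam →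
      ∀ ε : ℝ, 0 < ε →
      Matrix.of (fun i j : Fin K => if i = j then 0 else lam i j + ε) ∈ flowRegion p q W →
      ∃ π : Protocol K W, ∀ α : UserPair K → ProbabilityMeasure (ℕ → ℕ), HasRates α lam →
        SwitchStable p q π α) := by
  refine ⟨Set.Subset.antisymm ?_ ?_, fun lam hlam α hα π h => h.mem_flowRegion hlam hα, ?_⟩
  · refine closure_minimal ?_ (isClosed_flowRegion p q W)
    rintro lam ⟨hlam, π, hπ⟩
    obtain ⟨l, hl, rfl⟩ := hlam.exists_eq_rateMatrix
    choose α hα using fun e => exists_isRequestLaw (hl e)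
    have hrates : HasRates α (rateMatrix l) := fun i j hij => by
      rw [rateMatrix_of_ne l hij]
      exact hα _
    exact (hπ α hrates).mem_flowRegion hlam hrates
  · intro lam hlam
    obtain ⟨l, hl, rfl⟩ := hlam.1.exists_eq_rateMatrix
    obtain ⟨φ, hφ, hlφ⟩ := (rateMatrix_mem_flowRegion hl).1 hlam
    -- Scaling down makes the inequalities strict at the pairs whose rate does not vanish.
    have hlim : Tendsto (fun n : ℕ => rateMatrix fun e => (1 - 1 / ((n : ℝ) + 1)) * l e) atTop
        (𝓝 (rateMatrix l)) := by
      refine tendsto_pi_nhds.2 fun i => tendsto_pi_nhds.2 fun j => ?_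
      by_cases hij : i = j
      · simp [hij]
      · simp only [rateMatrix_of_ne _ hij]
        have := ((tendsto_one_div_add_atTop_nhds_zero_nat (𝕜 := ℝ)).const_sub 1).mul_const
          (l (userPair i j hij))
        simpa using this
    refine mem_closure_of_tendsto hlim (Eventually.of_forall fun n => ?_)
    have hn0 : 0 < 1 / ((n : ℝ) + 1) := by positivity
    have hn1 : 1 / ((n : ℝ) + 1) ≤ 1 := by
      rw [div_le_one (by positivity)]
      linarith [Nat.cast_nonneg (α := ℝ) n]
    have hnn : ∀ e, 0 ≤ (1 - 1 / ((n : ℝ) + 1)) * l e := fun e =>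
      mul_nonneg (by linarith) (hl e)
    refine ⟨isRateMatrix_rateMatrix hnn, exists_protocol_of_isFlow hnn hφ fun e => ?_⟩
    rcases (hl e).eq_or_lt with h0 | hpos
    · left
      rw [← h0, mul_zero]
    · right
      nlinarith [hlφ e, mul_pos hn0 hpos]
  · intro lam hlam ε hε hmem
    obtain ⟨l, hl, rfl⟩ := hlam.exists_eq_rateMatrix
    have heq : Matrix.of (fun i j : Fin K => if i = j then 0 else rateMatrix l i j + ε) =
        rateMatrix fun e => l e + ε := by
      ext i j
      by_cases hij : i = j
      · simp [hij]
      · rw [rateMatrix_of_ne _ hij, Matrix.of_apply, if_neg hij, rateMatrix_of_ne l hij]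
    rw [heq] at hmem
    obtain ⟨φ, hφ, hlφ⟩ := (rateMatrix_mem_flowRegion fun e => by
      have := hl e; positivity).1 hmem
    exact exists_protocol_of_isFlow hl hφ fun e => Or.inr (by linarith [hlφ e])
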